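/- For $r>0$ let $D(r)=\{z\in\mathbb{C}:|z|<r\}$. Let $n$ be a rank, $A$ a real number and $d>0$. A Higgs field on the trivial holomorphic bundle $D(1)\times\mathbb{C}^n$ is $\phi=f\,dz$ with $f:D(1)\to M_n(\mathbb{C})$ holomorphic. Its critical set is the set of points of $D(1)$ at which the number of generalized eigenspaces of $f$ (i.e. of distinct eigenvalues) is not maximal. Let $S_n(d,A)$ be the set of such $\phi$ with empty critical set, such that at every point of $D(1)$ any two distinct eigenvalues of $f$ are at distance at least $d$ from each other (no condition if there is only one eigenvalue), and all eigenvalues of $f$ have modulus at most $Ad$. For $\phi=f\,dz\in S_n(d,A)$ write $f=f_s+f_n$ for the pointwise Jordan--Chevalley decomposition ($f_s$ semisimple, $f_n$ nilpotent, $f_sf_n=f_nf_s$) and $\phi_n=f_n\,dz$. A harmonic metric for $\phi$ is a smooth Hermitian metric $h$ on the bundle over $D(1)$ that satisfies Hitchin's equation $F(h)+[\phi,\phi^{*_h}]=0$, where $F(h)$ is the curvature of the Chern connection of $h$ and $*_h$ is the adjoint with respect to $h$. Let $|\cdot|_h$ be the pointwise Hilbert--Schmidt norm on endomorphisms with respect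 to $h$; on endomorphism-valued forms it is the norm of the coefficient of $dz$, respectively of $dz\wedge d\bar z$. Theorem. For all $n$, $0<r<1$, $A$ and $d_0>0$ there is a constant $C=C(n,r,A,d_0)>0$ such that for every $d\ge d_0$, every $\phi\in S_n(d,A)$ and every harmonic metric $h$ for $\phi$, at every point of $D(r)$, $$|\phi_n|_h\le C\qquad\text{and}\qquad |F(h)|_h\le C .$$ In particular both bounds are uniform in $d$ as $d\to\infty$ (for $d\ge 1$ the constant depends only on $n$, $r$ and $A$). -/

import Mathlib

open scoped ContDiff Matrix ComplexOrder

noncomputable section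

namespace Higgs

/-- The open disk `D(r)` of radius `r` about the origin of `ℂ`. -/
abbrev disk (r : ℝ) : Set ℂ := Metric.ball 0 r

/-- The Wirtinger derivative `∂g/∂z = (∂g/∂x - i ∂g/∂y) / 2`. -/
def dz (g : ℂ → ℂ) (z : ℂ) : ℂ :=
  (fderiv ℝ g z 1 - Complex.I * fderiv ℝ g z Complex.I) / 2

/-- The Wirtinger derivative `∂g/∂z̄ = (∂g/∂x + i ∂g/∂y) / 2`. -/
def dzbar (g : ℂ → ℂ) (z : ℂ) : ℂ :=
  (fderiv ℝ g z 1 + Complex.I * fderiv ℝ g z Complex.I) / 2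

/-- Entrywise `∂/∂z` of a matrix-valued function. -/
def matDz {n : ℕ} (M : ℂ → Matrix (Fin n) (Fin n) ℂ) (z : ℂ) : Matrix (Fin n) (Fin n) ℂ :=
  Matrix.of fun i j => dz (fun w => M w i j) z

/-- Entrywise `∂/∂z̄` of a matrix-valued function. -/
def matDzbar {n : ℕ} (M : ℂ → Matrix (Fin n) (Fin n) ℂ) (z : ℂ) : Matrix (Fin n) (Fin n) ℂ :=
  Matrix.of fun i j => dzbar (fun w => M w i j) z

/-! ### Higgs fields on the trivial bundle over the unit disk -/

/-- `φ = f dz` is a Higgs field on the trivial rank `n` holomorphic bundle over `D(1)`: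
the matrix-valued function `f` is holomorphic on `D(1)`. -/
def IsHiggsField {n : ℕ} (f : ℂ → Matrix (Fin n) (Fin n) ℂ) : Prop :=
  ∀ i j, DifferentiableOn ℂ (fun z => f z i j) (disk 1)

/-- The set of (distinct) eigenvalues of a square complex matrix. -/
def eigenvalues {n : ℕ} (M : Matrix (Fin n) (Fin n) ℂ) : Set ℂ :=
  {μ | Module.End.HasEigenvalue (Matrix.toLin' M) μ}

/-- The number of generalized eigenspaces, that is, the number of distinct eigenvalues. -/
def numGenEigenspaces {n : ℕ} (M : Matrix (Fin n) (Fin n) ℂ) : ℕ :=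
  (eigenvalues M).ncard

/-- The critical set of `φ = f dz`: the points of `D(1)` at which the number of generalized
eigenspaces is not maximal. -/
def criticalSet {n : ℕ} (f : ℂ → Matrix (Fin n) (Fin n) ℂ) : Set ℂ :=
  {z ∈ disk 1 | ∃ w ∈ disk 1, numGenEigenspaces (f z) < numGenEigenspaces (f w)}

/-- The set `S_n(d, A)`: Higgs fields `φ = f dz` on the trivial rank `n` bundle over `D(1)` with
empty critical set, eigenvalue gap at least `d` (an empty condition where `f` has a single
eigenvalue), and all eigenvalues of modulus at most `A d`. -/
structure MemS (n : ℕ) (d A : ℝ) (f : ℂ → Matrix (Fin n) (Fin n) ℂ) : Prop where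
  isHiggsField : IsHiggsField f
  criticalSet_eq_empty : criticalSet f = ∅
  le_gap : ∀ z ∈ disk 1, ∀ α ∈ eigenvalues (f z), ∀ β ∈ eigenvalues (f z),
    α ≠ β → d ≤ ‖α - β‖
  norm_eigenvalue_le : ∀ z ∈ disk 1, ∀ α ∈ eigenvalues (f z), ‖α‖ ≤ A * d

/-! ### Jordan-Chevalley decomposition -/

/-- `M = S + N` is the Jordan-Chevalley decomposition of `M`: `S` is semisimple, `N` is nilpotent,
and they commute. -/
structure IsJordanChevalley {n : ℕ} (M S N : Matrix (Fin n) (Fin n) ℂ) : Prop where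
  add_eq : S + N = M
  commute : Commute S N
  isSemisimple : Module.End.IsSemisimple (Matrix.toLin' S)
  isNilpotent : IsNilpotent N

theorem exists_isJordanChevalley {n : ℕ} (M : Matrix (Fin n) (Fin n) ℂ) :
    ∃ N S : Matrix (Fin n) (Fin n) ℂ, IsJordanChevalley M S N := by
  have key : ∀ F : Module.End ℂ (Fin n → ℂ), ∃ N S : Module.End ℂ (Fin n → ℂ),
      S + N = F ∧ Commute S N ∧ S.IsSemisimple ∧ IsNilpotent N := by
    intro F
    obtain ⟨N, hN, S, hS, hNn, hSs, h⟩ := Module.End.exists_isNilpotent_isSemisimple (f := F)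
    have hFN : Commute F N := Algebra.commute_of_mem_adjoin_self hN
    refine ⟨N, S, ?_, ?_, hSs, hNn⟩
    · rw [h, add_comm]
    · have hS' : S = F - N := by rw [h, add_sub_cancel_left]
      rw [hS']
      exact hFN.sub_left (Commute.refl N)
  obtain ⟨N', S', h, hc, hS, hN⟩ := key (Matrix.toLinAlgEquiv' M)
  obtain ⟨N, rfl⟩ := Matrix.toLinAlgEquiv'.surjective N'
  obtain ⟨S, rfl⟩ := Matrix.toLinAlgEquiv'.surjective S'
  refine ⟨N, S, ⟨?_, ?_, hS, ?_⟩⟩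
  · apply Matrix.toLinAlgEquiv'.injective
    rw [map_add, h]
  · apply Matrix.toLinAlgEquiv'.injective
    rw [map_mul, map_mul]
    exact hc
  · exact (IsNilpotent.map_iff Matrix.toLinAlgEquiv'.injective).1 hN

/-- The nilpotent part of a matrix in its Jordan-Chevalley decomposition. -/
def nilpotentPart {n : ℕ} (M : Matrix (Fin n) (Fin n) ℂ) : Matrix (Fin n) (Fin n) ℂ :=
  (exists_isJordanChevalley M).choose

/-- The nilpotent part is the only matrix that occurs as the nilpotent summand of a
Jordan-Chevalley decomposition. -/
theorem isJordanChevalley_iff_nilpotentPart_eq {n : ℕ} (M N : Matrix (Fin n) (Fin n) ℂ) :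
    (∃ S, IsJordanChevalley M S N) ↔ nilpotentPart M = N := by
  have key : ∃ S, IsJordanChevalley M S (nilpotentPart M) :=
    (exists_isJordanChevalley M).choose_spec
  constructor
  · rintro ⟨S, h⟩
    obtain ⟨S', h'⟩ := key
    have hu := Module.End.isNilpotent_isSemisimple_unique
      (h'.isNilpotent.map Matrix.toLinAlgEquiv') h'.isSemisimple
      (h.isNilpotent.map Matrix.toLinAlgEquiv') h.isSemisimple
      (h'.commute.symm.map Matrix.toLinAlgEquiv') (h.commute.symm.map Matrix.toLinAlgEquiv')
      ((map_add Matrix.toLin' _ _).symm.trans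
        ((congrArg Matrix.toLin' (by rw [add_comm, h'.add_eq, add_comm, h.add_eq])).trans
          (map_add Matrix.toLin' _ _)))
    exact Matrix.toLinAlgEquiv'.injective hu.1
  · rintro rfl
    exact key

/-! ### Hermitian metrics on the trivial bundle and Hitchin's equation

A Hermitian metric `h` is given by its matrix `H` in the standard holomorphic frame,
`h(s, t) = t* H s`. -/

/-- `H` is the matrix of a smooth Hermitian metric on the trivial bundle over `D(1)`. -/
structure IsHermitianMetric {n : ℕ} (H : ℂ → Matrix (Fin n) (Fin n) ℂ) : Prop where
  contDiffOn : ∀ i j, ContDiffOn ℝ ∞ (fun z => H z i j) (disk 1)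
  posDef : ∀ z ∈ disk 1, (H z).PosDef

/-- The adjoint `g^{*_h} = H⁻¹ gᴴ H` of an endomorphism `g` of a fibre with metric matrix `H`:
`h(g s, t) = h(s, g^{*_h} t)`. -/
def hAdjoint {n : ℕ} (H g : Matrix (Fin n) (Fin n) ℂ) : Matrix (Fin n) (Fin n) ℂ :=
  H⁻¹ * gᴴ * H

/-- The Hilbert-Schmidt norm `|g|_h = (tr (g g^{*_h}))^{1/2}` of an endomorphism of a fibre. -/
def hNorm {n : ℕ} (H g : Matrix (Fin n) (Fin n) ℂ) : ℝ :=
  Real.sqrt (Matrix.trace (g * hAdjoint H g)).re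

/-- The connection matrix `H⁻¹ ∂H/∂z` of the Chern connection `d + H⁻¹ (∂H/∂z) dz` of `h` in the
standard holomorphic frame. -/
def chernConnection {n : ℕ} (H : ℂ → Matrix (Fin n) (Fin n) ℂ) (z : ℂ) :
    Matrix (Fin n) (Fin n) ℂ :=
  (H z)⁻¹ * matDz H z

/-- The coefficient of `dz ∧ dz̄` in the curvature
`F(h) = ∂/∂z̄ (H⁻¹ ∂H/∂z) dz̄ ∧ dz` of the Chern connection. -/
def chernCurvature {n : ℕ} (H : ℂ → Matrix (Fin n) (Fin n) ℂ) (z : ℂ) :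
    Matrix (Fin n) (Fin n) ℂ :=
  -matDzbar (chernConnection H) z

/-- `h` is a harmonic metric for `φ = f dz`: it is a smooth Hermitian metric that solves Hitchin's
equation `F(h) + [φ, φ^{*_h}] = 0` on `D(1)`. Here `φ^{*_h} = f^{*_h} dz̄`, so that
`[φ, φ^{*_h}] = φ ∧ φ^{*_h} + φ^{*_h} ∧ φ` has the coefficient `f f^{*_h} - f^{*_h} f` of
`dz ∧ dz̄`. -/
structure IsHarmonicMetric {n : ℕ} (f H : ℂ → Matrix (Fin n) (Fin n) ℂ) : Prop where
  isHermitianMetric : IsHermitianMetric H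
  hitchin : ∀ z ∈ disk 1,
    chernCurvature H z + (f z * hAdjoint (H z) (f z) - hAdjoint (H z) (f z) * f z) = 0

end Higgs

end

/-!
The proof combines a Bochner formula with a maximum principle, three times.

If `h` is harmonic for `φ = f dz` and `s` is a holomorphic endomorphism commuting with `f`, then
`∂̄∂ |s|² = |∇s|² + |[f*, s]|²` (`IsHarmonicMetric.bochner`). A lower bound of `|[f*, s]|` in terms of
`|s|` is therefore a differential inequality for `|s|²`, and comparison with the barrier
`(R² - |z|²)⁴` turns it into an interior bound that does not see the boundary values of `h`
(`exists_barrier_max`, `IsHarmonicMetric.hNorm_sq_le`). Each application shrinks the disk a little.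

* For `s = f` the required lower bound is Henrici's inequality: the departure of a matrix from
  normality is controlled by its commutator with its adjoint (`norm_sq_le_of_eigenvalues`). The
  result is `|f| ≤ c d` (`exists_hNorm_higgs_le`).
* Let `π_a` be the projections to the generalized eigenspaces of `f`. By the previous bound and the
  separation of the eigenvalues they are bounded, and `|[f*, π_a]| ≥ (d / K) |π_a - π_a*|`
  (`exists_norm_specProj_sub_conjTranspose_le`). Since `∑ |π_a|² - n` is half of `∑ |π_a - π_a*|²`,
  this function `u ≥ 0` satisfies `∂̄∂ u ≥ 2 (d / K)² u`; the barrier gives `u = O(d⁻²)`, the exponent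
  `4` of the barrier leaves room to use this twice, and `u = O(d⁻⁴)` (`exists_excess_le`). So the
  projections are Hermitian up to `O(d⁻²)`.
* Consequently `f_s`, which is `∑ a π_a` with `|a| ≤ A d`, is normal up to `O(d⁻¹)`, in the sense
  that `d |[f_s*, y]| = O(|y|)` for polynomials `y` in `f` (`norm_commutator_sub_le`). Henrici's
  inequality for the nilpotent `f_n` now yields `|f_n|² ≤ n² (|[f*, f_n]| + O(|f_n| / d))`, and
  `s = f_n` gives the bound of `f_n` (`exists_hNorm_nilpotentPart_le`). The same commutator estimates
  bound the curvature, which is `-[f, f*]` (`hNorm_chernCurvature_le`).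

That `π_a` and `f_n` are holomorphic is where the empty critical set enters: as the number of
eigenvalues is constant, so are their multiplicities locally, and an eigenvalue of multiplicity `m`
is a simple root of the `(m - 1)`-st derivative of the characteristic polynomial
(`IsSeparatedFamily.exists_holomorphic_roots`). The projections are explicit polynomials in `f` and
its eigenvalues (`specPoly`).
-/

noncomputable section

namespace Higgs

open Filter Topology ComplexConjugate

/-! ### Wirtinger calculus -/

/-- `g` is real differentiable at `z` with `∂g/∂z = p` and `∂g/∂z̄ = q`: its differential is
`p dz + q dz̄`. -/
def HasWirtingerAt (g : ℂ → ℂ) (p q z : ℂ) : Prop :=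
  HasFDerivAt g (p • (1 : ℂ →L[ℝ] ℂ) + q • (Complex.conjCLE : ℂ →L[ℝ] ℂ)) z

namespace HasWirtingerAt

variable {g g₁ g₂ : ℂ → ℂ} {p q p₁ q₁ p₂ q₂ z : ℂ}

theorem dz_eq (h : HasWirtingerAt g p q z) : dz g z = p := by
  have h' : fderiv ℝ g z = _ := HasFDerivAt.fderiv h
  simp only [dz, h', add_apply, smul_apply,
    one_apply_eq_self, ContinuousLinearEquiv.coe_coe, Complex.conjCLE_apply,
    map_one, Complex.conj_I, smul_eq_mul]
  linear_combination (-(p - q) / 2) * Complex.I_mul_I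

theorem dzbar_eq (h : HasWirtingerAt g p q z) : dzbar g z = q := by
  have h' : fderiv ℝ g z = _ := HasFDerivAt.fderiv h
  simp only [dzbar, h', add_apply, smul_apply,
    one_apply_eq_self, ContinuousLinearEquiv.coe_coe, Complex.conjCLE_apply,
    map_one, Complex.conj_I, smul_eq_mul]
  linear_combination ((p - q) / 2) * Complex.I_mul_I

theorem of_differentiableAt (h : DifferentiableAt ℝ g z) :
    HasWirtingerAt g (dz g z) (dzbar g z) z := by
  have h1 := h.hasFDerivAt
  refine h1.congr_fderiv ?_
  refine ContinuousLinearMap.ext fun w => ?_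
  have hw : fderiv ℝ g z w = w.re * fderiv ℝ g z 1 + w.im * fderiv ℝ g z Complex.I := by
    conv_lhs => rw [show w = w.re • (1 : ℂ) + w.im • Complex.I by
      simp [Complex.re_add_im]]
    rw [map_add, map_smul, map_smul]
    simp
  rw [hw]
  simp only [dz, dzbar, add_apply, smul_apply,
    one_apply_eq_self, ContinuousLinearEquiv.coe_coe, Complex.conjCLE_apply,
    smul_eq_mul]
  have e1 : w = w.re + w.im * Complex.I := (Complex.re_add_im w).symm
  have e2 : conj w = w.re - w.im * Complex.I := by
    apply Complex.ext <;> simp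
  rw [e2]
  conv_rhs => rw [e1]
  simp only [Complex.add_re, Complex.ofReal_re, Complex.mul_re, Complex.I_re, Complex.I_im,
    Complex.ofReal_im, Complex.add_im, Complex.mul_im]
  simp only [mul_zero, mul_one, sub_zero, add_zero, zero_add]
  linear_combination (w.im * fderiv ℝ g z Complex.I) * Complex.I_mul_I

theorem of_hasDerivAt {g' : ℂ} (h : HasDerivAt g g' z) : HasWirtingerAt g g' 0 z := by
  have h1 := h.hasFDerivAt.restrictScalars ℝ
  refine h1.congr_fderiv ?_
  refine ContinuousLinearMap.ext fun w => ?_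
  simp [mul_comm]

theorem const (c z : ℂ) : HasWirtingerAt (fun _ => c) 0 0 z :=
  of_hasDerivAt (hasDerivAt_const z c)

theorem congr_of_eventuallyEq (h : HasWirtingerAt g p q z) (h₁ : g₁ =ᶠ[𝓝 z] g) :
    HasWirtingerAt g₁ p q z :=
  HasFDerivAt.congr_of_eventuallyEq h h₁

theorem add (h₁ : HasWirtingerAt g₁ p₁ q₁ z) (h₂ : HasWirtingerAt g₂ p₂ q₂ z) :
    HasWirtingerAt (fun w => g₁ w + g₂ w) (p₁ + p₂) (q₁ + q₂) z := by
  refine (HasFDerivAt.add h₁ h₂).congr_fderiv ?_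
  refine ContinuousLinearMap.ext fun w => ?_
  simp; ring

theorem sub (h₁ : HasWirtingerAt g₁ p₁ q₁ z) (h₂ : HasWirtingerAt g₂ p₂ q₂ z) :
    HasWirtingerAt (fun w => g₁ w - g₂ w) (p₁ - p₂) (q₁ - q₂) z := by
  refine (HasFDerivAt.sub h₁ h₂).congr_fderiv ?_
  refine ContinuousLinearMap.ext fun w => ?_
  simp; ring

theorem mul (h₁ : HasWirtingerAt g₁ p₁ q₁ z) (h₂ : HasWirtingerAt g₂ p₂ q₂ z) :
    HasWirtingerAt (fun w => g₁ w * g₂ w) (p₁ * g₂ z + g₁ z * p₂) (q₁ * g₂ z + g₁ z * q₂) z := by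
  refine (HasFDerivAt.mul h₁ h₂).congr_fderiv ?_
  refine ContinuousLinearMap.ext fun w => ?_
  simp; ring

theorem sum {ι : Type*} {s : Finset ι} {g : ι → ℂ → ℂ} {p q : ι → ℂ}
    (h : ∀ i ∈ s, HasWirtingerAt (g i) (p i) (q i) z) :
    HasWirtingerAt (fun w => ∑ i ∈ s, g i w) (∑ i ∈ s, p i) (∑ i ∈ s, q i) z := by
  refine (HasFDerivAt.fun_sum h).congr_fderiv ?_
  refine ContinuousLinearMap.ext fun w => ?_
  simp [Finset.sum_add_distrib, Finset.sum_mul]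

theorem conjugate (h : HasWirtingerAt g p q z) :
    HasWirtingerAt (fun w => conj (g w)) (conj q) (conj p) z := by
  have h1 := (Complex.conjCLE : ℂ ≃L[ℝ] ℂ).toContinuousLinearMap.hasFDerivAt.comp z h
  refine h1.congr_fderiv ?_
  refine ContinuousLinearMap.ext fun w => ?_
  simp; ring

theorem unique (h₁ : HasWirtingerAt g p₁ q₁ z) (h₂ : HasWirtingerAt g p₂ q₂ z) :
    p₁ = p₂ ∧ q₁ = q₂ :=
  ⟨h₁.dz_eq.symm.trans h₂.dz_eq, h₁.dzbar_eq.symm.trans h₂.dzbar_eq⟩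

/-- The Wirtinger derivatives of a real valued function are complex conjugates. -/
theorem conj_eq_of_real {g : ℂ → ℝ} (h : HasWirtingerAt (fun w => (g w : ℂ)) p q z) :
    q = conj p := by
  have h1 := h.conjugate
  simp only [Complex.conj_ofReal] at h1
  exact (h.unique h1).2

theorem hasDerivAt_line {g : ℂ → ℂ} {z e : ℂ} {t : ℝ}
    (h : HasWirtingerAt g p q (z + t * e)) :
    HasDerivAt (fun s : ℝ => g (z + s * e)) (p * e + q * conj e) t := by
  have hl : HasDerivAt (fun s : ℝ => z + (s : ℂ) * e) e t := by
    simpa using ((Complex.ofRealCLM.hasDerivAt (x := t)).mul_const e).const_add z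
  have := HasFDerivAt.comp_hasDerivAt (l := g) (f := fun s : ℝ => z + (s : ℂ) * e) t h hl
  exact this.congr_deriv (by simp)

end HasWirtingerAt

/-! ### The maximum principle -/

theorem second_deriv_nonpos_of_isLocalMax {φ φ' : ℝ → ℝ} {c t : ℝ} (hmax : IsLocalMax φ t)
    (h₁ : ∀ᶠ s in 𝓝 t, HasDerivAt φ (φ' s) s) (h₂ : HasDerivAt φ' c t) : c ≤ 0 := by
  by_contra! hc
  have e1 : deriv φ =ᶠ[𝓝 t] φ' := h₁.mono fun s hs => hs.deriv
  have e2 : deriv (deriv φ) t = c := by rw [e1.deriv_eq, h₂.deriv]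
  have hmin : IsLocalMin φ t :=
    isLocalMin_of_deriv_deriv_pos (by rw [e2]; exact hc) hmax.deriv_eq_zero
      h₁.self_of_nhds.continuousAt
  have e3 : φ =ᶠ[𝓝 t] fun _ => φ t := by
    filter_upwards [hmax, hmin] with s h h' using le_antisymm h h'
  have e4 : deriv φ =ᶠ[𝓝 t] fun _ => 0 := by
    have := e3.deriv
    simpa using this
  have : deriv (deriv φ) t = 0 := by rw [e4.deriv_eq]; simp
  linarith

/-- At a local maximum of a real function `g`, the derivative `∂g/∂z` vanishes and
`∂²g/∂z̄∂z`, a quarter of the Laplacian, is nonpositive. -/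
theorem wirtinger_of_isLocalMax {g : ℂ → ℝ} {p q : ℂ → ℂ} {z a b : ℂ} (hmax : IsLocalMax g z)
    (h₁ : ∀ᶠ w in 𝓝 z, HasWirtingerAt (fun w => (g w : ℂ)) (p w) (q w) w)
    (h₂ : HasWirtingerAt p a b z) : p z = 0 ∧ b.re ≤ 0 := by
  have hline : ∀ e : ℂ, Tendsto (fun t : ℝ => z + (t : ℂ) * e) (𝓝 0) (𝓝 z) := by
    intro e
    have : Continuous fun t : ℝ => z + (t : ℂ) * e := by fun_prop
    simpa using this.tendsto 0
  have hd : ∀ e : ℂ, ∀ᶠ t : ℝ in 𝓝 0,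
      HasDerivAt (fun s : ℝ => g (z + s * e)) (2 * (p (z + t * e) * e).re) t := by
    intro e
    filter_upwards [(hline e).eventually h₁] with t ht
    have h := (ht.hasDerivAt_line)
    have hr := (Complex.reCLM.hasFDerivAt.comp_hasDerivAt t h)
    have hq := ht.conj_eq_of_real
    rw [hq] at hr
    have e1 : (Complex.reCLM ∘ fun s : ℝ => ((g (z + s * e) : ℝ) : ℂ)) =
        fun s : ℝ => g (z + s * e) := by ext s; simp
    rw [e1] at hr
    have e2 : Complex.reCLM (p (z + ↑t * e) * e + conj (p (z + ↑t * e)) * conj e) =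
        2 * (p (z + ↑t * e) * e).re := by
      rw [← map_mul, Complex.reCLM_apply, Complex.add_re, Complex.conj_re]
      ring
    rwa [e2] at hr
  have hm : ∀ e : ℂ, IsLocalMax (fun s : ℝ => g (z + s * e)) 0 := by
    intro e
    have := (hline e).eventually hmax
    filter_upwards [this] with t ht
    simpa using ht
  have hp : ∀ e : ℂ, (p z * e).re = 0 := by
    intro e
    have h := (hm e).hasDerivAt_eq_zero (hd e).self_of_nhds
    simpa using h
  have hsec : ∀ e : ℂ, ((a * e + b * conj e) * e).re ≤ 0 := by
    intro e
    have h0 : HasWirtingerAt p a b (z + ((0 : ℝ) : ℂ) * e) := by simpa using h₂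
    have h := h0.hasDerivAt_line.mul_const e
    have hr := (Complex.reCLM.hasFDerivAt.comp_hasDerivAt (0 : ℝ) h).const_mul 2
    have := second_deriv_nonpos_of_isLocalMax (hm e) (hd e) hr
    simp only [Complex.reCLM_apply] at this
    linarith
  constructor
  · apply Complex.ext
    · simpa using hp 1
    · simpa using hp Complex.I
  · have h1 := hsec 1
    have h2 := hsec Complex.I
    simp at h1 h2
    linarith

/-- A maximum principle with a polynomial barrier. The function `ρ (R² - |z|²)⁴` attains its
maximum over the disk of radius `R` at an interior point, and there the second derivatives of `ρ`
and of `log ρ` are bounded above in terms of the barrier `(R² - |z|²)⁴`. -/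
theorem exists_barrier_max {ρ : ℂ → ℝ} {R : ℝ} (hR₀ : 0 < R) (hR₁ : R < 1)
    (hc : ContinuousOn ρ (disk 1)) (hρ : ∀ z ∈ disk 1, 0 ≤ ρ z) :
    ∃ z ∈ disk R, (∀ w ∈ disk R,
        ρ w * (R ^ 2 - ‖w‖ ^ 2) ^ 4 ≤ ρ z * (R ^ 2 - ‖z‖ ^ 2) ^ 4) ∧
      ∀ (p q : ℂ → ℂ) (a b : ℂ),
        (∀ᶠ w in 𝓝 z, HasWirtingerAt (fun w => (ρ w : ℂ)) (p w) (q w) w) →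
        HasWirtingerAt p a b z →
        (R ^ 2 - ‖z‖ ^ 2) ^ 2 * b.re ≤ 20 * ρ z ∧
        (R ^ 2 - ‖z‖ ^ 2) ^ 2 * (ρ z * b.re - ‖p z‖ ^ 2) ≤ 4 * ρ z ^ 2 := by
  set G : ℂ → ℝ := fun w => ρ w * (R ^ 2 - ‖w‖ ^ 2) ^ 4 with hG
  have hsub : Metric.closedBall (0 : ℂ) R ⊆ disk 1 := Metric.closedBall_subset_ball hR₁
  have hGc : ContinuousOn G (Metric.closedBall 0 R) :=
    (hc.mono hsub).mul (by fun_prop)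
  -- a maximum on the boundary has the value `0`, and is then attained at the centre too
  obtain ⟨z, hz, hmax⟩ : ∃ z ∈ disk R, ∀ w ∈ disk R, G w ≤ G z := by
    obtain ⟨z, hz, hmax⟩ := (isCompact_closedBall (0 : ℂ) R).exists_isMaxOn
      ⟨0, by simp [hR₀.le]⟩ hGc
    by_cases hzR : z ∈ disk R
    · exact ⟨z, hzR, fun w hw => hmax (Metric.ball_subset_closedBall hw)⟩
    · have hzn : ‖z‖ = R := by
        have h1 : ‖z‖ ≤ R := by simpa using hz
        have h2 : R ≤ ‖z‖ := by simpa using hzR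
        exact le_antisymm h1 h2
      have hGz : G z = 0 := by simp [hG, hzn]
      refine ⟨0, by simpa using hR₀, fun w hw => ?_⟩
      have h1 : G w ≤ G z := hmax (Metric.ball_subset_closedBall hw)
      have h2 : 0 ≤ G 0 := mul_nonneg (hρ 0 (by simp)) (by positivity)
      linarith
  refine ⟨z, hz, hmax, fun p q a b h₁ h₂ => ?_⟩
  have hloc : IsLocalMax G z :=
    Filter.mem_of_superset (Metric.isOpen_ball.mem_nhds hz) fun w hw => hmax w hw
  set κ : ℂ → ℂ := fun w => (R : ℂ) ^ 2 - w * conj w with hκ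
  have hκ' : ∀ w, κ w = ((R ^ 2 - ‖w‖ ^ 2 : ℝ) : ℂ) := by
    intro w
    simp only [hκ, Complex.mul_conj, Complex.normSq_eq_norm_sq]
    push_cast; ring
  have hid : ∀ w, HasWirtingerAt (fun w : ℂ => w) 1 0 w :=
    fun w => .of_hasDerivAt (hasDerivAt_id w)
  have hcj : ∀ w, HasWirtingerAt (fun w : ℂ => conj w) 0 1 w := by
    intro w; simpa using (hid w).conjugate
  have dκ : ∀ w, HasWirtingerAt κ (-conj w) (-w) w := by
    intro w
    have := (HasWirtingerAt.const ((R : ℂ) ^ 2) w).sub ((hid w).mul (hcj w))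
    simpa using this
  have dκ3 : ∀ w, HasWirtingerAt (fun w => κ w ^ 3) (3 * κ w ^ 2 * (-conj w))
      (3 * κ w ^ 2 * (-w)) w := by
    intro w
    have h := ((dκ w).mul (dκ w)).mul (dκ w)
    have e : (fun w => κ w ^ 3) = fun w => κ w * κ w * κ w := by ext w; ring
    rw [e]
    convert h using 1 <;> ring
  have dκ4 : ∀ w, HasWirtingerAt (fun w => κ w ^ 4) (-4 * (κ w ^ 3 * conj w))
      (-4 * (κ w ^ 3 * w)) w := by
    intro w
    have h := (dκ3 w).mul (dκ w)
    have e : (fun w => κ w ^ 4) = fun w => κ w ^ 3 * κ w := by ext w; ring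
    rw [e]
    convert h using 1 <;> ring
  have dp : HasWirtingerAt (fun w => -4 * (κ w ^ 3 * conj w))
      (-4 * (3 * κ z ^ 2 * (-conj z) * conj z)) (-4 * (3 * κ z ^ 2 * (-z) * conj z + κ z ^ 3)) z := by
    have h := (HasWirtingerAt.const (-4) z).mul ((dκ3 z).mul (hcj z))
    convert h using 1 <;> ring
  have hGe : (fun w => (G w : ℂ)) = fun w => (ρ w : ℂ) * κ w ^ 4 := by
    ext w; rw [hκ']; simp [hG]
  have dG : ∀ᶠ w in 𝓝 z, HasWirtingerAt (fun w => (G w : ℂ))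
      (p w * κ w ^ 4 + ρ w * (-4 * (κ w ^ 3 * conj w)))
      (q w * κ w ^ 4 + ρ w * (-4 * (κ w ^ 3 * w))) w := by
    filter_upwards [h₁] with w hw
    rw [hGe]
    exact hw.mul (dκ4 w)
  have d2 := (h₂.mul (dκ4 z)).add (h₁.self_of_nhds.mul dp)
  obtain ⟨e1, e2⟩ := wirtinger_of_isLocalMax hloc dG d2
  have hq := h₁.self_of_nhds.conj_eq_of_real
  rw [hq] at e2
  have hzR : ‖z‖ < R := by simpa using hz
  set k : ℝ := R ^ 2 - ‖z‖ ^ 2 with hk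
  have hk0 : 0 < k := by
    have := norm_nonneg z
    rw [hk]; nlinarith
  rw [hκ' z, ← hk] at e1 e2
  have hkc : (k : ℂ) ≠ 0 := by exact_mod_cast hk0.ne'
  have e3 : p z * k = 4 * ρ z * conj z := by
    have : (k : ℂ) ^ 3 * (p z * k - 4 * ρ z * conj z) = 0 := by linear_combination e1
    have := (mul_eq_zero.1 this).resolve_left (pow_ne_zero _ hkc)
    linear_combination this
  have hzz : z * conj z = ((‖z‖ ^ 2 : ℝ) : ℂ) := by
    rw [Complex.mul_conj, Complex.normSq_eq_norm_sq]
  have hpn : ‖p z‖ ^ 2 * k ^ 2 = 16 * ρ z ^ 2 * ‖z‖ ^ 2 := by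
    have h := congrArg (fun x : ℂ => ‖x‖ ^ 2) e3
    simp only [norm_mul, mul_pow, Complex.norm_real, RCLike.norm_conj] at h
    rw [Real.norm_eq_abs, Real.norm_eq_abs, sq_abs, sq_abs] at h
    norm_num at h
    exact h
  have hpz : (p z * z) * k = ((4 * ρ z * ‖z‖ ^ 2 : ℝ) : ℂ) := by
    push_cast
    push_cast at hzz
    linear_combination z * e3 + 4 * ρ z * hzz
  have hpz' : (p z * z).re * k = 4 * ρ z * ‖z‖ ^ 2 := by
    have := congrArg Complex.re hpz
    rwa [Complex.re_mul_ofReal, Complex.ofReal_re] at this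
  have e4 : k ^ 2 * (k ^ 2 * b.re - 8 * ((p z * z).re * k) + ρ z * (12 * ‖z‖ ^ 2 - 4 * k)) ≤ 0 := by
    have hre : b * (k : ℂ) ^ 4 + p z * (-4 * ((k : ℂ) ^ 3 * z)) +
        (conj (p z) * (-4 * ((k : ℂ) ^ 3 * conj z)) +
          ρ z * (-4 * (3 * (k : ℂ) ^ 2 * (-z) * conj z + (k : ℂ) ^ 3))) =
        ((k ^ 4 : ℝ) : ℂ) * b + ((-4 * k ^ 3 : ℝ) : ℂ) * (p z * z)
          + ((-4 * k ^ 3 : ℝ) : ℂ) * conj (p z * z)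
          + ((ρ z * (12 * k ^ 2 * ‖z‖ ^ 2 - 4 * k ^ 3) : ℝ) : ℂ) := by
      rw [map_mul]
      push_cast
      push_cast at hzz
      linear_combination 12 * ρ z * k ^ 2 * hzz
    rw [hre] at e2
    simp only [Complex.add_re, Complex.re_ofReal_mul, Complex.conj_re, Complex.ofReal_re] at e2
    linarith
  have e5 := nonpos_of_mul_nonpos_right e4 (by positivity)
  rw [hpz'] at e5
  have hρz := hρ z (hsub (Metric.ball_subset_closedBall hz))
  have hR2 : R ^ 2 ≤ 1 := by nlinarith
  have hz2 : ‖z‖ ^ 2 ≤ 1 := by nlinarith [norm_nonneg z]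
  have hkR : k = R ^ 2 - ‖z‖ ^ 2 := hk
  constructor
  · nlinarith [mul_nonneg hρz (sub_nonneg.2 hR2), mul_nonneg hρz (sub_nonneg.2 hz2)]
  · have : k ^ 2 * (ρ z * b.re - ‖p z‖ ^ 2) = ρ z * (k ^ 2 * b.re) - ‖p z‖ ^ 2 * k ^ 2 := by ring
    rw [this, hpn]
    have h6 : ρ z * (k ^ 2 * b.re) ≤ ρ z * (ρ z * (20 * ‖z‖ ^ 2 + 4 * k)) :=
      mul_le_mul_of_nonneg_left (by linarith) hρz
    have h7 : 0 ≤ ρ z * ρ z * (1 - R ^ 2) := mul_nonneg (mul_nonneg hρz hρz) (by linarith)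
    rw [hkR] at h6
    nlinarith

end Higgs

namespace Higgs

open Filter Topology ComplexConjugate

variable {n : ℕ}

/-! ### Unitary frames -/

section
open scoped MatrixOrder Matrix.Norms.L2Operator

theorem exists_frame {H : Matrix (Fin n) (Fin n) ℂ} (hH : H.PosDef) :
    ∃ P : Matrix (Fin n) (Fin n) ℂ, IsUnit P.det ∧ H = Pᴴ * P := by
  obtain ⟨P, hP⟩ := CStarAlgebra.nonneg_iff_eq_star_mul_self.mp hH.posSemidef.nonneg
  refine ⟨P, ?_, hP⟩
  have h := hH.det_pos.ne'
  rw [hP, Matrix.det_mul] at h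
  exact (right_ne_zero_of_mul h).isUnit

end

open scoped Matrix.Norms.Frobenius

theorem frobenius_sq (A : Matrix (Fin n) (Fin n) ℂ) : ‖A‖ ^ 2 = ∑ i, ∑ j, ‖A i j‖ ^ 2 := by
  rw [Matrix.frobenius_norm_def, ← Real.sqrt_eq_rpow]
  rw [Real.sq_sqrt (Finset.sum_nonneg fun i _ => Finset.sum_nonneg fun j _ => by positivity)]
  simp

theorem trace_mul_conjTranspose_self (A : Matrix (Fin n) (Fin n) ℂ) :
    (A * Aᴴ).trace = ((‖A‖ ^ 2 : ℝ) : ℂ) := by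
  rw [frobenius_sq]
  simp [Matrix.trace, Matrix.mul_apply, Complex.mul_conj, Complex.normSq_eq_norm_sq]

theorem norm_trace_mul_conjTranspose_le (A B : Matrix (Fin n) (Fin n) ℂ) :
    ‖(A * Bᴴ).trace‖ ≤ ‖A‖ * ‖B‖ := by
  have h1 : ‖(A * Bᴴ).trace‖ ≤ ∑ x : Fin n × Fin n, ‖A x.1 x.2‖ * ‖B x.1 x.2‖ := by
    simp only [Matrix.trace, Matrix.diag_apply, Matrix.mul_apply, Matrix.conjTranspose_apply]
    rw [← Fintype.sum_prod_type']
    refine (norm_sum_le _ _).trans (Finset.sum_le_sum fun x _ => ?_)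
    simp
  have h2 := Finset.sum_mul_sq_le_sq_mul_sq Finset.univ
    (fun x : Fin n × Fin n => ‖A x.1 x.2‖) (fun x => ‖B x.1 x.2‖)
  have e : ∀ A : Matrix (Fin n) (Fin n) ℂ, ∑ x : Fin n × Fin n, ‖A x.1 x.2‖ ^ 2 = ‖A‖ ^ 2 :=
    fun A => by rw [frobenius_sq, Fintype.sum_prod_type' fun i j => ‖A i j‖ ^ 2]
  rw [e, e, ← mul_pow] at h2
  exact h1.trans (abs_le_of_sq_le_sq' h2 (by positivity)).2

theorem hAdjoint_mul {H : Matrix (Fin n) (Fin n) ℂ} (hH : IsUnit H.det)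
    (A B : Matrix (Fin n) (Fin n) ℂ) : hAdjoint H (A * B) = hAdjoint H B * hAdjoint H A := by
  simp only [hAdjoint, Matrix.conjTranspose_mul, mul_assoc, Matrix.mul_nonsing_inv_cancel_left _ _ hH]

theorem hAdjoint_sub (H A B : Matrix (Fin n) (Fin n) ℂ) :
    hAdjoint H (A - B) = hAdjoint H A - hAdjoint H B := by
  simp [hAdjoint, mul_sub, sub_mul]

theorem hAdjoint_hAdjoint {H : Matrix (Fin n) (Fin n) ℂ} (hH : IsUnit H.det)
    (hH' : Hᴴ = H) (A : Matrix (Fin n) (Fin n) ℂ) : hAdjoint H (hAdjoint H A) = A := by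
  simp only [hAdjoint, Matrix.conjTranspose_mul, Matrix.conjTranspose_conjTranspose,
    Matrix.conjTranspose_nonsing_inv, hH', mul_assoc, Matrix.nonsing_inv_mul _ hH,
    Matrix.nonsing_inv_mul_cancel_left _ _ hH, mul_one]

/-- The matrix of the endomorphism `A` in the frame `P`. -/
def inFrame (P A : Matrix (Fin n) (Fin n) ℂ) : Matrix (Fin n) (Fin n) ℂ := P * A * P⁻¹

section inFrame

variable {P : Matrix (Fin n) (Fin n) ℂ}

theorem inFrame_mul (hP : IsUnit P.det) (A B : Matrix (Fin n) (Fin n) ℂ) :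
    inFrame P (A * B) = inFrame P A * inFrame P B := by
  simp only [inFrame, mul_assoc, Matrix.nonsing_inv_mul_cancel_left _ _ hP]

theorem inFrame_sub (A B : Matrix (Fin n) (Fin n) ℂ) :
    inFrame P (A - B) = inFrame P A - inFrame P B := by
  simp [inFrame, mul_sub, sub_mul]

theorem inFrame_hAdjoint (hP : IsUnit P.det) (A : Matrix (Fin n) (Fin n) ℂ) :
    inFrame P (hAdjoint (Pᴴ * P) A) = (inFrame P A)ᴴ := by
  simp only [inFrame, hAdjoint, Matrix.conjTranspose_mul, Matrix.mul_inv_rev, mul_assoc,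
    Matrix.mul_nonsing_inv_cancel_left _ _ hP, Matrix.conjTranspose_nonsing_inv,
    Matrix.mul_nonsing_inv _ hP, mul_one]

theorem trace_inFrame (hP : IsUnit P.det) (A : Matrix (Fin n) (Fin n) ℂ) :
    (inFrame P A).trace = A.trace := by
  rw [inFrame, Matrix.trace_mul_comm, Matrix.nonsing_inv_mul_cancel_left _ _ hP]

theorem trace_mul_hAdjoint (hP : IsUnit P.det) (A B : Matrix (Fin n) (Fin n) ℂ) :
    (A * hAdjoint (Pᴴ * P) B).trace = (inFrame P A * (inFrame P B)ᴴ).trace := by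
  rw [← trace_inFrame hP, inFrame_mul hP, inFrame_hAdjoint hP]

theorem hNorm_eq_norm_inFrame (hP : IsUnit P.det) (A : Matrix (Fin n) (Fin n) ℂ) :
    hNorm (Pᴴ * P) A = ‖inFrame P A‖ := by
  rw [hNorm, trace_mul_hAdjoint hP, trace_mul_conjTranspose_self, Complex.ofReal_re,
    Real.sqrt_sq (norm_nonneg _)]

end inFrame

theorem trace_mul_hAdjoint_self {H : Matrix (Fin n) (Fin n) ℂ} (hH : H.PosDef)
    (A : Matrix (Fin n) (Fin n) ℂ) : (A * hAdjoint H A).trace = ((hNorm H A ^ 2 : ℝ) : ℂ) := by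
  obtain ⟨P, hP, rfl⟩ := exists_frame hH
  rw [hNorm_eq_norm_inFrame hP, trace_mul_hAdjoint hP, trace_mul_conjTranspose_self]

theorem norm_trace_mul_hAdjoint_le {H : Matrix (Fin n) (Fin n) ℂ} (hH : H.PosDef)
    (A B : Matrix (Fin n) (Fin n) ℂ) :
    ‖(A * hAdjoint H B).trace‖ ≤ hNorm H A * hNorm H B := by
  obtain ⟨P, hP, rfl⟩ := exists_frame hH
  rw [hNorm_eq_norm_inFrame hP, hNorm_eq_norm_inFrame hP, trace_mul_hAdjoint hP]
  exact norm_trace_mul_conjTranspose_le _ _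

theorem hNorm_nonneg (H A : Matrix (Fin n) (Fin n) ℂ) : 0 ≤ hNorm H A := Real.sqrt_nonneg _

/-! ### Wirtinger calculus of matrix valued functions -/

/-- `M` has the Wirtinger derivatives `∂M/∂z = P` and `∂M/∂z̄ = Q` at `z`, entrywise. -/
def HasMatWirtingerAt (M : ℂ → Matrix (Fin n) (Fin n) ℂ) (P Q : Matrix (Fin n) (Fin n) ℂ)
    (z : ℂ) : Prop :=
  ∀ i j, HasWirtingerAt (fun w => M w i j) (P i j) (Q i j) z

theorem differentiableAt_det {M : ℂ → Matrix (Fin n) (Fin n) ℂ} {z : ℂ}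
    (h : ∀ i j, DifferentiableAt ℝ (fun w => M w i j) z) :
    DifferentiableAt ℝ (fun w => (M w).det) z := by
  simp only [Matrix.det_apply]
  refine DifferentiableAt.fun_sum fun σ _ => ?_
  refine DifferentiableAt.fun_const_smul ?_ _
  exact (HasFDerivAt.finsetProd fun i _ => (h (σ i) i).hasFDerivAt).differentiableAt

namespace HasMatWirtingerAt

variable {M M₁ M₂ : ℂ → Matrix (Fin n) (Fin n) ℂ} {P Q P₁ Q₁ P₂ Q₂ : Matrix (Fin n) (Fin n) ℂ}
  {z : ℂ}

theorem unique (h₁ : HasMatWirtingerAt M P₁ Q₁ z) (h₂ : HasMatWirtingerAt M P₂ Q₂ z) :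
    P₁ = P₂ ∧ Q₁ = Q₂ :=
  ⟨Matrix.ext fun i j => ((h₁ i j).unique (h₂ i j)).1,
    Matrix.ext fun i j => ((h₁ i j).unique (h₂ i j)).2⟩

theorem of_differentiableAt (h : ∀ i j, DifferentiableAt ℝ (fun w => M w i j) z) :
    HasMatWirtingerAt M (matDz M z) (matDzbar M z) z :=
  fun i j => HasWirtingerAt.of_differentiableAt (h i j)

theorem differentiableAt (h : HasMatWirtingerAt M P Q z) (i j : Fin n) :
    DifferentiableAt ℝ (fun w => M w i j) z :=
  HasFDerivAt.differentiableAt (h i j)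

theorem congr_of_eventuallyEq (h : HasMatWirtingerAt M P Q z) (h₁ : M₁ =ᶠ[𝓝 z] M) :
    HasMatWirtingerAt M₁ P Q z := fun i j =>
  (h i j).congr_of_eventuallyEq (h₁.mono fun w hw => by simp only [hw])

theorem const (A : Matrix (Fin n) (Fin n) ℂ) (z : ℂ) :
    HasMatWirtingerAt (fun _ => A) 0 0 z := fun _ _ => .const _ _

theorem add (h₁ : HasMatWirtingerAt M₁ P₁ Q₁ z) (h₂ : HasMatWirtingerAt M₂ P₂ Q₂ z) :
    HasMatWirtingerAt (fun w => M₁ w + M₂ w) (P₁ + P₂) (Q₁ + Q₂) z :=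
  fun i j => (h₁ i j).add (h₂ i j)

theorem sub (h₁ : HasMatWirtingerAt M₁ P₁ Q₁ z) (h₂ : HasMatWirtingerAt M₂ P₂ Q₂ z) :
    HasMatWirtingerAt (fun w => M₁ w - M₂ w) (P₁ - P₂) (Q₁ - Q₂) z :=
  fun i j => (h₁ i j).sub (h₂ i j)

theorem mul (h₁ : HasMatWirtingerAt M₁ P₁ Q₁ z) (h₂ : HasMatWirtingerAt M₂ P₂ Q₂ z) :
    HasMatWirtingerAt (fun w => M₁ w * M₂ w) (P₁ * M₂ z + M₁ z * P₂) (Q₁ * M₂ z + M₁ z * Q₂) z := by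
  intro i j
  have h := HasWirtingerAt.sum (s := Finset.univ)
    fun k (_ : k ∈ Finset.univ) => (h₁ i k).mul (h₂ k j)
  simp only [Finset.sum_add_distrib] at h
  simpa only [Matrix.mul_apply, Matrix.add_apply] using h

theorem conjTranspose (h : HasMatWirtingerAt M P Q z) :
    HasMatWirtingerAt (fun w => (M w)ᴴ) Qᴴ Pᴴ z :=
  fun i j => (h j i).conjugate

theorem trace (h : HasMatWirtingerAt M P Q z) :
    HasWirtingerAt (fun w => (M w).trace) P.trace Q.trace z :=
  HasWirtingerAt.sum fun i _ => h i i

theorem inv (h : HasMatWirtingerAt M P Q z) (hM : ∀ᶠ w in 𝓝 z, IsUnit (M w).det) :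
    HasMatWirtingerAt (fun w => (M w)⁻¹) (-((M z)⁻¹ * P * (M z)⁻¹)) (-((M z)⁻¹ * Q * (M z)⁻¹))
      z := by
  have hz := hM.self_of_nhds
  have hdiff : ∀ i j, DifferentiableAt ℝ (fun w => (M w)⁻¹ i j) z := by
    intro i j
    have hdet := differentiableAt_det h.differentiableAt
    have hadj : DifferentiableAt ℝ (fun w => (M w).adjugate i j) z := by
      simp only [Matrix.adjugate_apply]
      refine differentiableAt_det fun k l => ?_
      simp only [Matrix.updateRow_apply]
      split_ifs
      · exact differentiableAt_const _
      · exact h.differentiableAt k l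
    have := (hdet.fun_inv hz.ne_zero).fun_mul hadj
    simpa [Matrix.inv_def, Ring.inverse_eq_inv'] using this
  have hd := of_differentiableAt hdiff
  have h1 : HasMatWirtingerAt (fun w => (M w)⁻¹ * M w) 0 0 z :=
    (const 1 z).congr_of_eventuallyEq (hM.mono fun w hw => Matrix.nonsing_inv_mul _ hw)
  obtain ⟨e1, e2⟩ := (hd.mul h).unique h1
  have key : ∀ X Y : Matrix (Fin n) (Fin n) ℂ, X * M z + (M z)⁻¹ * Y = 0 →
      X = -((M z)⁻¹ * Y * (M z)⁻¹) := by
    intro X Y hXY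
    have := congrArg (· * (M z)⁻¹) hXY
    simp only [add_mul, zero_mul, Matrix.mul_nonsing_inv_cancel_right _ _ hz] at this
    exact eq_neg_of_add_eq_zero_left this
  rw [← key _ _ e1, ← key _ _ e2]
  exact hd

theorem of_hasDerivAt {D : Matrix (Fin n) (Fin n) ℂ}
    (h : ∀ i j, HasDerivAt (fun w => M w i j) (D i j) z) : HasMatWirtingerAt M D 0 z :=
  fun i j => HasWirtingerAt.of_hasDerivAt (h i j)

end HasMatWirtingerAt

/-! ### The Bochner formula -/

namespace IsHermitianMetric

variable {H : ℂ → Matrix (Fin n) (Fin n) ℂ} {z : ℂ}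

theorem isUnit_det (hH : IsHermitianMetric H) (hz : z ∈ disk 1) : IsUnit (H z).det :=
  (hH.posDef z hz).det_pos.ne'.isUnit

theorem conjTranspose_eq (hH : IsHermitianMetric H) (hz : z ∈ disk 1) : (H z)ᴴ = H z :=
  (hH.posDef z hz).isHermitian

theorem hasMatWirtingerAt (hH : IsHermitianMetric H) (hz : z ∈ disk 1) :
    HasMatWirtingerAt H (matDz H z) ((matDz H z)ᴴ) z := by
  have hmem : disk 1 ∈ 𝓝 z := Metric.isOpen_ball.mem_nhds hz
  have h := HasMatWirtingerAt.of_differentiableAt (M := H) (z := z) fun i j =>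
    ((hH.contDiffOn i j).contDiffAt hmem).differentiableAt (by simp)
  have h' := h.conjTranspose.congr_of_eventuallyEq
    (Filter.mem_of_superset hmem fun w hw => (hH.conjTranspose_eq hw).symm)
  obtain ⟨-, e⟩ := h.unique h'
  rwa [e] at h

theorem differentiableAt_matDz (hH : IsHermitianMetric H) (hz : z ∈ disk 1) (i j : Fin n) :
    DifferentiableAt ℝ (fun w => matDz H w i j) z := by
  have hmem : disk 1 ∈ 𝓝 z := Metric.isOpen_ball.mem_nhds hz
  have h : DifferentiableAt ℝ (fderiv ℝ fun w => H w i j) z :=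
    (((hH.contDiffOn i j).fderiv_of_isOpen (m := ∞) Metric.isOpen_ball
      (by simp)).contDiffAt hmem).differentiableAt (by simp)
  simp only [matDz, dz, Matrix.of_apply]
  fun_prop

/-- The second derivative of the squared norm of a holomorphic endomorphism `s`:
`∂̄⟨∇s, s⟩ = |∇s|² - ⟨[F, s], s⟩`, where `∇s = s' + [H⁻¹∂H, s]` is the covariant derivative. -/
theorem hasWirtingerAt_hNorm_sq (hH : IsHermitianMetric H) (hz : z ∈ disk 1)
    {s : ℂ → Matrix (Fin n) (Fin n) ℂ}
    (hs : ∀ᶠ w in 𝓝 z, ∀ i j, DifferentiableAt ℂ (fun w => s w i j) w) :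
    ∃ p q : ℂ → ℂ, ∃ a : ℂ, ∃ D : Matrix (Fin n) (Fin n) ℂ,
      (∀ᶠ w in 𝓝 z, HasWirtingerAt (fun w => ((hNorm (H w) (s w) ^ 2 : ℝ) : ℂ)) (p w) (q w) w) ∧
      p z = (D * hAdjoint (H z) (s z)).trace ∧
      HasWirtingerAt p a (((s z * chernCurvature H z - chernCurvature H z * s z) *
        hAdjoint (H z) (s z)).trace + (D * hAdjoint (H z) D).trace) z := by
  set s' : ℂ → Matrix (Fin n) (Fin n) ℂ := fun w => .of fun i j => deriv (fun w => s w i j) w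
    with hs'
  set c : ℂ → Matrix (Fin n) (Fin n) ℂ := chernConnection H with hc
  set D : ℂ → Matrix (Fin n) (Fin n) ℂ := fun w => s' w + c w * s w - s w * c w with hD
  have hmem : disk 1 ∈ 𝓝 z := Metric.isOpen_ball.mem_nhds hz
  have ds : ∀ᶠ w in 𝓝 z, HasMatWirtingerAt s (s' w) 0 w := by
    filter_upwards [hs] with w hw
    exact .of_hasDerivAt fun i j => (hw i j).hasDerivAt
  have dadj : ∀ᶠ w in 𝓝 z, HasMatWirtingerAt (fun w => hAdjoint (H w) (s w))
      (hAdjoint (H w) (s w) * c w - c w * hAdjoint (H w) (s w)) (hAdjoint (H w) (D w)) w := by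
    filter_upwards [ds, hmem] with w hw hw1
    have hu := hH.isUnit_det hw1
    have hinv := (hH.hasMatWirtingerAt hw1).inv
      (Filter.mem_of_superset (Metric.isOpen_ball.mem_nhds hw1) fun x hx => hH.isUnit_det hx)
    have h := (hinv.mul hw.conjTranspose).mul (hH.hasMatWirtingerAt hw1)
    simp only [hAdjoint]
    convert h using 1
    · simp only [hc, chernConnection, Matrix.conjTranspose_zero, mul_zero, add_zero, neg_mul,
        mul_assoc, Matrix.mul_nonsing_inv_cancel_left _ _ hu]
      abel
    · simp only [hD, hc, chernConnection, Matrix.conjTranspose_add, Matrix.conjTranspose_sub,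
        Matrix.conjTranspose_mul, Matrix.conjTranspose_nonsing_inv, hH.conjTranspose_eq hw1,
        mul_add, mul_sub, add_mul, sub_mul, neg_mul, mul_assoc, Matrix.nonsing_inv_mul _ hu,
        mul_one]
      abel
  refine ⟨fun w => (D w * hAdjoint (H w) (s w)).trace, fun w => (s w * hAdjoint (H w) (D w)).trace,
    ?_⟩
  have d1 : ∀ᶠ w in 𝓝 z, HasWirtingerAt (fun w => ((hNorm (H w) (s w) ^ 2 : ℝ) : ℂ))
      ((D w * hAdjoint (H w) (s w)).trace) ((s w * hAdjoint (H w) (D w)).trace) w := by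
    filter_upwards [ds, dadj, hmem] with w h1 h2 hw
    have h := (h1.mul h2).trace
    refine HasWirtingerAt.congr_of_eventuallyEq (g := fun w => (s w * hAdjoint (H w) (s w)).trace)
      ?_ ?_
    · convert h using 1
      · simp only [hD, Matrix.trace_add, Matrix.trace_sub, add_mul, sub_mul, mul_sub, mul_assoc]
        rw [Matrix.trace_mul_comm (c w), mul_assoc, add_sub_assoc]
      · simp
    · filter_upwards [Metric.isOpen_ball.mem_nhds hw] with x hx
      exact (trace_mul_hAdjoint_self (hH.posDef x hx) (s x)).symm
  have dc : HasMatWirtingerAt c (matDz c z) (-chernCurvature H z) z := by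
    have hinv := (hH.hasMatWirtingerAt hz).inv
      (Filter.mem_of_superset hmem fun x hx => hH.isUnit_det hx)
    have h := hinv.mul (HasMatWirtingerAt.of_differentiableAt (hH.differentiableAt_matDz hz))
    rw [chernCurvature, neg_neg]
    exact .of_differentiableAt h.differentiableAt
  have ds' : HasMatWirtingerAt s' (.of fun i j => deriv (fun w => s' w i j) z) 0 z := by
    refine .of_hasDerivAt fun i j => DifferentiableAt.hasDerivAt ?_
    have ha : AnalyticAt ℂ (fun w => s w i j) z :=
      Complex.analyticAt_iff_eventually_differentiableAt.2 (hs.mono fun w hw => hw i j)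
    exact ha.deriv.differentiableAt
  have dsz := ds.self_of_nhds
  have dD := (ds'.add (dc.mul dsz)).sub (dsz.mul dc)
  have h := (dD.mul dadj.self_of_nhds).trace
  have e : ((0 + (-chernCurvature H z * s z + c z * 0) - (0 * c z + s z * -chernCurvature H z)) *
      hAdjoint (H z) (s z) + D z * hAdjoint (H z) (D z)).trace =
      ((s z * chernCurvature H z - chernCurvature H z * s z) * hAdjoint (H z) (s z)).trace +
        (D z * hAdjoint (H z) (D z)).trace := by
    rw [Matrix.trace_add]
    congr 3
    simp only [neg_mul, mul_neg, mul_zero, zero_mul, add_zero, zero_add]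
    abel
  exact ⟨_, D z, d1, rfl, e ▸ h⟩

end IsHermitianMetric

theorem trace_commutator_commutator {f g s t : Matrix (Fin n) (Fin n) ℂ} (h : Commute f s) :
    (((f * g - g * f) * s - s * (f * g - g * f)) * t).trace =
      ((g * s - s * g) * (t * f - f * t)).trace := by
  have e1 : (g * s * t * f).trace = (f * g * s * t).trace := by
    rw [Matrix.trace_mul_comm]; simp only [mul_assoc]
  have e2 : (s * g * t * f).trace = (s * f * g * t).trace := by
    rw [Matrix.trace_mul_comm, ← h.eq]; simp only [mul_assoc]
  have e3 : g * s * f * t = g * f * s * t := by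
    rw [mul_assoc g s f, ← h.eq, ← mul_assoc]
  simp only [sub_mul, mul_sub, Matrix.trace_sub, ← mul_assoc] at *
  rw [e1, e2, e3]
  ring

/-- The Bochner formula. If `h` is harmonic for `f dz` and `s` is a holomorphic endomorphism that
commutes with `f`, then `∂̄∂|s|² = |∇s|² + |[f*, s]|²` and `∂|s|² = ⟨∇s, s⟩`. The conclusion drops the
term `|∇s|²`, or absorbs it by Cauchy-Schwarz. -/
theorem IsHarmonicMetric.bochner {f H : ℂ → Matrix (Fin n) (Fin n) ℂ} {z : ℂ}
    (hH : IsHarmonicMetric f H) (hz : z ∈ disk 1) {s : ℂ → Matrix (Fin n) (Fin n) ℂ}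
    (hs : ∀ᶠ w in 𝓝 z, ∀ i j, DifferentiableAt ℂ (fun w => s w i j) w)
    (hcomm : Commute (f z) (s z)) :
    ∃ p q : ℂ → ℂ, ∃ a b : ℂ,
      (∀ᶠ w in 𝓝 z, HasWirtingerAt (fun w => ((hNorm (H w) (s w) ^ 2 : ℝ) : ℂ)) (p w) (q w) w) ∧
      HasWirtingerAt p a b z ∧
      hNorm (H z) (hAdjoint (H z) (f z) * s z - s z * hAdjoint (H z) (f z)) ^ 2 ≤ b.re ∧
      hNorm (H z) (s z) ^ 2 *
        hNorm (H z) (hAdjoint (H z) (f z) * s z - s z * hAdjoint (H z) (f z)) ^ 2 ≤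
          hNorm (H z) (s z) ^ 2 * b.re - ‖p z‖ ^ 2 := by
  obtain ⟨p, q, a, D, h1, h2, h3⟩ := hH.isHermitianMetric.hasWirtingerAt_hNorm_sq hz hs
  have hpos := hH.isHermitianMetric.posDef z hz
  have hu := hH.isHermitianMetric.isUnit_det hz
  have hF : chernCurvature H z = -(f z * hAdjoint (H z) (f z) - hAdjoint (H z) (f z) * f z) :=
    eq_neg_of_add_eq_zero_left (hH.hitchin z hz)
  have e : ((s z * chernCurvature H z - chernCurvature H z * s z) *
        hAdjoint (H z) (s z)).trace + (D * hAdjoint (H z) D).trace =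
      ((hNorm (H z) (hAdjoint (H z) (f z) * s z - s z * hAdjoint (H z) (f z)) ^ 2 +
        hNorm (H z) D ^ 2 : ℝ) : ℂ) := by
    rw [Complex.ofReal_add, ← trace_mul_hAdjoint_self hpos, ← trace_mul_hAdjoint_self hpos,
      hAdjoint_sub, hAdjoint_mul hu, hAdjoint_mul hu,
      hAdjoint_hAdjoint hu (hH.isHermitianMetric.conjTranspose_eq hz),
      ← trace_commutator_commutator hcomm, hF]
    congr 3
    noncomm_ring
  rw [e] at h3
  refine ⟨p, q, a, _, h1, h3, ?_, ?_⟩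
  · rw [Complex.ofReal_re]
    nlinarith [sq_nonneg (hNorm (H z) D)]
  · rw [Complex.ofReal_re, h2]
    have h4 := norm_trace_mul_hAdjoint_le hpos D (s z)
    have h5 := pow_le_pow_left₀ (norm_nonneg _) h4 2
    rw [mul_pow] at h5
    linarith

end Higgs

namespace Higgs

open scoped Matrix.Norms.Frobenius
open Polynomial

variable {n : ℕ}

/-! ### Departure from normality -/

/-- Schur triangulation: an orthonormal family in which `T` is upper triangular. -/
theorem exists_orthonormal_triangular (n : ℕ) : ∀ {V : Type} [NormedAddCommGroup V]
    [InnerProductSpace ℂ V] [FiniteDimensional ℂ V], Module.finrank ℂ V = n →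
    ∀ T : V →ₗ[ℂ] V, ∃ v : Fin n → V, Orthonormal ℂ v ∧
      ∀ i j, j < i → inner ℂ (v i) (T (v j)) = 0 := by
  induction n with
  | zero =>
    intro V _ _ _ _ T
    exact ⟨Fin.elim0, ⟨fun i => i.elim0, fun i => i.elim0⟩, fun i => i.elim0⟩
  | succ n ih =>
    intro V _ _ _ hV T
    have : Nontrivial V := Module.nontrivial_of_finrank_pos (R := ℂ) (by omega)
    -- an eigenvector of the adjoint spans the complement of an invariant hyperplane
    obtain ⟨μ, hμ⟩ := Module.End.exists_eigenvalue (LinearMap.adjoint T)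
    obtain ⟨u₀, hu₀⟩ := hμ.exists_hasEigenvector
    set u : V := ((‖u₀‖ : ℂ)⁻¹) • u₀ with hu
    have hn0 : ‖u₀‖ ≠ 0 := norm_ne_zero_iff.2 hu₀.2
    have hu1 : ‖u‖ = 1 := by
      rw [hu, norm_smul, norm_inv, Complex.norm_real, norm_norm, inv_mul_cancel₀ hn0]
    have huT : LinearMap.adjoint T u = μ • u := by
      rw [hu, map_smul, hu₀.apply_eq_smul, smul_comm]
    set W : Submodule ℂ V := (ℂ ∙ u)ᗮ with hW
    have hu_ne : u ≠ 0 := by rw [← norm_ne_zero_iff, hu1]; exact one_ne_zero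
    have hTW : ∀ w ∈ W, T w ∈ W := by
      intro w hw
      rw [hW, Submodule.mem_orthogonal_singleton_iff_inner_right] at hw ⊢
      rw [← LinearMap.adjoint_inner_left, huT, inner_smul_left, hw, mul_zero]
    have hWn : Module.finrank ℂ W = n := by
      have : Fact (Module.finrank ℂ V = n + 1) := ⟨hV⟩
      exact Submodule.finrank_orthogonal_span_singleton hu_ne
    obtain ⟨v, hv, hvT⟩ := ih hWn (T.restrict hTW)
    have hvu : ∀ i, inner ℂ u (v i : V) = 0 := fun i =>
      (Submodule.mem_orthogonal_singleton_iff_inner_right).1 (v i).2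
    have hTu : ∀ i, inner ℂ u (T (v i : V)) = 0 := fun i =>
      (Submodule.mem_orthogonal_singleton_iff_inner_right).1 (hTW _ (v i).2)
    refine ⟨Fin.snoc (fun i => (v i : V)) u, ?_, ?_⟩
    · rw [orthonormal_iff_ite] at hv ⊢
      intro i j
      refine Fin.lastCases ?_ (fun i => ?_) i <;> refine Fin.lastCases ?_ (fun j => ?_) j
      · simp [hu1]
      · simp only [Fin.snoc_last, Fin.snoc_castSucc, hvu]
        rw [if_neg (Fin.castSucc_lt_last j).ne']
      · simp only [Fin.snoc_last, Fin.snoc_castSucc]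
        rw [← inner_conj_symm, hvu, map_zero, if_neg (Fin.castSucc_lt_last i).ne]
      · simpa using hv i j
    · intro i j
      refine Fin.lastCases ?_ (fun i => ?_) i <;> refine Fin.lastCases ?_ (fun j => ?_) j
      · intro h; exact absurd h (lt_irrefl _)
      · intro _; simpa using hTu j
      · intro h; exact absurd h (Fin.castSucc_lt_last i).not_gt
      · intro h
        have := hvT i j (by simpa using h)
        simpa using this

theorem exists_unitary_triangular (M : Matrix (Fin n) (Fin n) ℂ) :
    ∃ U : Matrix (Fin n) (Fin n) ℂ, Uᴴ * U = 1 ∧ (Uᴴ * M * U).IsUpperTriangular := by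
  obtain ⟨v, hv, hvT⟩ := exists_orthonormal_triangular n (V := EuclideanSpace ℂ (Fin n)) (by simp)
    (Matrix.toEuclideanLin M)
  refine ⟨.of fun i j => v j i, ?_, ?_⟩
  · ext i j
    rw [orthonormal_iff_ite] at hv
    have := hv i j
    rw [EuclideanSpace.inner_eq_star_dotProduct] at this
    rw [Matrix.one_apply, ← this]
    simp [Matrix.mul_apply, dotProduct, mul_comm]
  · intro i j hij
    have := hvT i j hij
    rw [EuclideanSpace.inner_eq_star_dotProduct] at this
    rw [← this, mul_assoc]
    simp [Matrix.mul_apply, dotProduct, Matrix.mulVec, mul_comm]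

theorem norm_unitary_conj {U : Matrix (Fin n) (Fin n) ℂ} (hU : Uᴴ * U = 1)
    (A : Matrix (Fin n) (Fin n) ℂ) : ‖Uᴴ * A * U‖ = ‖A‖ := by
  have hU' : U * Uᴴ = 1 := mul_eq_one_comm.1 hU
  have h : ((‖Uᴴ * A * U‖ ^ 2 : ℝ) : ℂ) = ((‖A‖ ^ 2 : ℝ) : ℂ) := by
    rw [← trace_mul_conjTranspose_self, ← trace_mul_conjTranspose_self]
    simp only [Matrix.conjTranspose_mul, Matrix.conjTranspose_conjTranspose]
    have : Uᴴ * A * U * (Uᴴ * (Aᴴ * U)) = Uᴴ * (A * Aᴴ * U) := by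
      calc _ = Uᴴ * A * (U * Uᴴ) * Aᴴ * U := by simp only [mul_assoc]
        _ = _ := by rw [hU']; simp only [mul_assoc, mul_one]
    rw [this, Matrix.trace_mul_comm, mul_assoc, hU', mul_one]
  have h2 : ‖Uᴴ * A * U‖ ^ 2 = ‖A‖ ^ 2 := by exact_mod_cast h
  exact (pow_left_inj₀ (norm_nonneg _) (norm_nonneg _) two_ne_zero).1 h2

theorem norm_entry_le (A : Matrix (Fin n) (Fin n) ℂ) (i j : Fin n) : ‖A i j‖ ≤ ‖A‖ := by
  refine (abs_le_of_sq_le_sq' ?_ (norm_nonneg _)).2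
  rw [frobenius_sq]
  exact (Finset.single_le_sum (f := fun j => ‖A i j‖ ^ 2) (fun _ _ => by positivity)
    (Finset.mem_univ j)).trans (Finset.single_le_sum (f := fun i => ∑ j, ‖A i j‖ ^ 2)
      (fun _ _ => by positivity) (Finset.mem_univ i))

theorem mem_eigenvalues_iff {M : Matrix (Fin n) (Fin n) ℂ} {μ : ℂ} :
    μ ∈ eigenvalues M ↔ M.charpoly.IsRoot μ := by
  rw [eigenvalues, Set.mem_ofPred_eq, Module.End.hasEigenvalue_iff_isRoot_charpoly,
    Matrix.charpoly_toLin']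

/-- For an upper triangular matrix `T`, the sum of the first diagonal entries of `[T, Tᴴ]` is the
sum of the `|T k j|²` over the upper right block that it cuts off. -/
theorem sum_norm_sq_le_of_isUpperTriangular {T : Matrix (Fin n) (Fin n) ℂ}
    (hT : T.IsUpperTriangular) (m : Fin n) :
    ∑ j ∈ Finset.univ.filter (m < ·), ‖T m j‖ ^ 2 ≤ n * ‖T * Tᴴ - Tᴴ * T‖ := by
  set K := T * Tᴴ - Tᴴ * T with hK
  have hdiag : ∀ k, K k k = ((∑ j, ‖T k j‖ ^ 2 - ∑ j, ‖T j k‖ ^ 2 : ℝ) : ℂ) := by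
    intro k
    simp [hK, Matrix.mul_apply, Complex.mul_conj, Complex.conj_mul', Complex.normSq_eq_norm_sq]
  have hsum : ∑ k ∈ Finset.univ.filter (· ≤ m), (∑ j, ‖T k j‖ ^ 2 - ∑ j, ‖T j k‖ ^ 2) =
      ∑ k ∈ Finset.univ.filter (· ≤ m), ∑ j ∈ Finset.univ.filter (m < ·), ‖T k j‖ ^ 2 := by
    rw [Finset.sum_sub_distrib]
    have e1 : ∑ k ∈ Finset.univ.filter (· ≤ m), ∑ j, ‖T j k‖ ^ 2 =
        ∑ k ∈ Finset.univ.filter (· ≤ m), ∑ j ∈ Finset.univ.filter (· ≤ m), ‖T j k‖ ^ 2 := by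
      refine Finset.sum_congr rfl fun k hk => ?_
      refine (Finset.sum_subset (Finset.subset_univ _) fun j _ hj => ?_).symm
      simp only [Finset.mem_filter, Finset.mem_univ, true_and, not_le] at hk hj
      rw [hT (show k < j from hk.trans_lt hj)]
      simp
    have e2 := Finset.sum_comm (s := Finset.univ.filter (· ≤ m))
      (t := Finset.univ.filter (· ≤ m)) (f := fun k j => ‖T j k‖ ^ 2)
    rw [e1, e2, ← Finset.sum_sub_distrib]
    refine Finset.sum_congr rfl fun k _ => ?_
    rw [sub_eq_iff_eq_add, add_comm,
      ← Finset.sum_filter_add_sum_filter_not Finset.univ (· ≤ m)]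
    simp only [not_le]
  have h1 : ∑ j ∈ Finset.univ.filter (m < ·), ‖T m j‖ ^ 2 ≤
      ∑ k ∈ Finset.univ.filter (· ≤ m), (∑ j, ‖T k j‖ ^ 2 - ∑ j, ‖T j k‖ ^ 2) := by
    rw [hsum]
    exact Finset.single_le_sum
      (f := fun k => ∑ j ∈ Finset.univ.filter (m < ·), ‖T k j‖ ^ 2)
      (fun _ _ => Finset.sum_nonneg fun _ _ => by positivity) (by simp)
  refine h1.trans ?_
  have h2 : ∀ k, ∑ j, ‖T k j‖ ^ 2 - ∑ j, ‖T j k‖ ^ 2 ≤ ‖K‖ := by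
    intro k
    have h := norm_entry_le K k k
    rw [hdiag, Complex.norm_real] at h
    exact (le_abs_self _).trans h
  refine (Finset.sum_le_card_nsmul _ _ _ fun k _ => h2 k).trans ?_
  rw [nsmul_eq_mul]
  gcongr
  simpa using Finset.card_filter_le (Finset.univ : Finset (Fin n)) (· ≤ m)

/-- The norm of a matrix is controlled by its eigenvalues and its commutator with its adjoint. -/
theorem norm_sq_le_of_eigenvalues {M : Matrix (Fin n) (Fin n) ℂ} {B : ℝ}
    (hB : ∀ μ ∈ eigenvalues M, ‖μ‖ ≤ B) :
    ‖M‖ ^ 2 ≤ n * B ^ 2 + n ^ 2 * ‖M * Mᴴ - Mᴴ * M‖ := by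
  obtain ⟨U, hU, hT⟩ := exists_unitary_triangular M
  have hU' : U * Uᴴ = 1 := mul_eq_one_comm.1 hU
  set T := Uᴴ * M * U with hTdef
  have hTK : T * Tᴴ - Tᴴ * T = Uᴴ * (M * Mᴴ - Mᴴ * M) * U := by
    have e : ∀ A B : Matrix (Fin n) (Fin n) ℂ,
        (Uᴴ * A * U) * (Uᴴ * B * U) = Uᴴ * (A * B) * U := by
      intro A B
      calc _ = Uᴴ * A * (U * Uᴴ) * B * U := by simp only [mul_assoc]
        _ = _ := by rw [hU']; simp only [mul_assoc, mul_one]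
    have e2 : Tᴴ = Uᴴ * Mᴴ * U := by
      simp [hTdef, Matrix.conjTranspose_mul, mul_assoc]
    rw [e2, hTdef, e, e, mul_sub, sub_mul]
  have hdiag : ∀ i, ‖T i i‖ ≤ B := by
    intro i
    refine hB _ (mem_eigenvalues_iff.2 ?_)
    have hc : M.charpoly = T.charpoly := by
      rw [hTdef, Matrix.charpoly_mul_comm, ← mul_assoc, hU', one_mul]
    rw [hc, Matrix.charpoly_of_isUpperTriangular _ hT, IsRoot.def, eval_prod]
    exact Finset.prod_eq_zero (Finset.mem_univ i) (by simp)
  rw [← norm_unitary_conj hU M, ← norm_unitary_conj hU (M * Mᴴ - Mᴴ * M), ← hTK, ← hTdef,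
    frobenius_sq]
  have hrow : ∀ i, ∑ j, ‖T i j‖ ^ 2 ≤ B ^ 2 + n * ‖T * Tᴴ - Tᴴ * T‖ := by
    intro i
    have h1 := sum_norm_sq_le_of_isUpperTriangular hT i
    have h2 : ‖T i i‖ ^ 2 ≤ B ^ 2 := pow_le_pow_left₀ (norm_nonneg _) (hdiag i) 2
    rw [← Finset.sum_filter_add_sum_filter_not Finset.univ (i < ·)]
    have h3 : ∑ j ∈ Finset.univ.filter (fun j => ¬ i < j), ‖T i j‖ ^ 2 = ‖T i i‖ ^ 2 := by
      refine Finset.sum_eq_single_of_mem i (by simp) fun j hj hji => ?_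
      simp only [Finset.mem_filter, Finset.mem_univ, true_and, not_lt] at hj
      rw [hT (show j < i from lt_of_le_of_ne hj hji)]
      simp
    rw [h3]
    linarith
  refine (Finset.sum_le_card_nsmul _ _ _ fun i _ => hrow i).trans ?_
  rw [nsmul_eq_mul, Finset.card_univ, Fintype.card_fin]
  exact le_of_eq (by ring)

/-! ### Inverting an operator with large eigenvalues -/

theorem norm_le_of_aeval_prod_eq_zero {V : Type*} [NormedAddCommGroup V] [NormedSpace ℂ V]
    (T : V →ₗ[ℂ] V) {d c : ℝ} (hd : 0 < d) (hc : 0 ≤ c) (hT : ∀ x, ‖T x‖ ≤ c * d * ‖x‖)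
    (s : Multiset ℂ) : (∀ μ ∈ s, d ≤ ‖μ‖ ∧ ‖μ‖ ≤ c * d) →
    ∀ x, aeval T (s.map fun μ => X - C μ).prod x = 0 →
      ‖x‖ ≤ (1 + 2 * c) ^ Multiset.card s / d * ‖T x‖ := by
  induction s using Multiset.induction_on with
  | empty =>
    intro _ x hx
    have : x = 0 := by simpa using hx
    simp [this]
  | cons μ s ih =>
    intro hs x hx
    have hμ := hs μ (Multiset.mem_cons_self _ _)
    have hμ0 : 0 < ‖μ‖ := hd.trans_le hμ.1
    set y := T x - μ • x with hy
    have hy0 : aeval T (s.map fun μ => X - C μ).prod y = 0 := by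
      rw [Multiset.map_cons, Multiset.prod_cons, mul_comm, map_mul] at hx
      simpa [hy, Module.algebraMap_end_apply] using hx
    have h1 := ih (fun ν hν => hs ν (Multiset.mem_cons_of_mem hν)) y hy0
    have h2 : ‖T y‖ ≤ 2 * c * d * ‖T x‖ := by
      have e : T y = T (T x) - μ • T x := by rw [hy, map_sub, map_smul]
      rw [e]
      refine (norm_sub_le _ _).trans ?_
      rw [norm_smul]
      have := hT (T x)
      have := mul_le_mul_of_nonneg_right hμ.2 (norm_nonneg (T x))
      linarith
    have h3 : ‖μ‖ * ‖x‖ ≤ ‖T x‖ + ‖y‖ := by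
      rw [← norm_smul]
      have : μ • x = T x - y := by rw [hy]; abel
      rw [this]
      exact norm_sub_le _ _
    have hk : 0 ≤ (1 + 2 * c) ^ Multiset.card s / d := by positivity
    have h4 : ‖y‖ ≤ 2 * c * (1 + 2 * c) ^ Multiset.card s * ‖T x‖ := by
      refine h1.trans ((mul_le_mul_of_nonneg_left h2 hk).trans (le_of_eq ?_))
      field_simp
    have h5 : d * ‖x‖ ≤ (1 + 2 * c) ^ (Multiset.card s + 1) * ‖T x‖ := by
      have h6 : d * ‖x‖ ≤ ‖μ‖ * ‖x‖ := mul_le_mul_of_nonneg_right hμ.1 (norm_nonneg _)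
      have h7 : 1 ≤ (1 + 2 * c) ^ Multiset.card s := one_le_pow₀ (by linarith)
      have h8 : ‖T x‖ ≤ (1 + 2 * c) ^ Multiset.card s * ‖T x‖ :=
        le_mul_of_one_le_left (norm_nonneg _) h7
      rw [pow_succ]
      linarith
    rw [Multiset.card_cons, div_mul_eq_mul_div, le_div_iff₀ hd]
    linarith

/-- An operator of norm at most `c d` all of whose eigenvalues have modulus at least `d` is bounded
below by a multiple of `d` that depends only on `c` and the dimension. -/
theorem norm_le_of_hasEigenvalue {V : Type*} [NormedAddCommGroup V] [NormedSpace ℂ V]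
    [FiniteDimensional ℂ V] (T : V →ₗ[ℂ] V) {d c : ℝ} (hd : 0 < d) (hc : 0 ≤ c)
    (hT : ∀ x, ‖T x‖ ≤ c * d * ‖x‖) (hev : ∀ μ, Module.End.HasEigenvalue T μ → d ≤ ‖μ‖) (x : V) :
    ‖x‖ ≤ (1 + 2 * c) ^ Module.finrank ℂ V / d * ‖T x‖ := by
  have hsplit := IsAlgClosed.splits (LinearMap.charpoly T)
  have hprod := hsplit.eq_prod_roots_of_monic (LinearMap.charpoly_monic T)
  have hcard : Multiset.card (LinearMap.charpoly T).roots = Module.finrank ℂ V := by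
    rw [← hsplit.natDegree_eq_card_roots, LinearMap.charpoly_natDegree]
  rw [← hcard]
  refine norm_le_of_aeval_prod_eq_zero T hd hc hT _ (fun μ hμ => ?_) x ?_
  · have h : Module.End.HasEigenvalue T μ :=
      (Module.End.hasEigenvalue_iff_isRoot_charpoly T μ).2 (isRoot_of_mem_roots hμ)
    refine ⟨hev μ h, ?_⟩
    obtain ⟨v, hv⟩ := h.exists_hasEigenvector
    have h1 := hT v
    rw [hv.apply_eq_smul, norm_smul] at h1
    exact le_of_mul_le_mul_right h1 (norm_pos_iff.2 hv.2)
  · rw [← hprod, LinearMap.aeval_self_charpoly]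
    rfl

end Higgs

namespace Higgs

open scoped Matrix.Norms.Frobenius
open Polynomial

variable {n : ℕ}

/-! ### Spectral projections -/

/-- A polynomial that is `1` modulo `(X - a) ^ m` and `0` modulo `(X - b) ^ m` for the other
elements `b` of `S`. Applied to a matrix with set of eigenvalues `S` it yields the projection to the
generalized eigenspace of `a`; being explicit, it is bounded and depends holomorphically on `S`. -/
def specPoly (m : ℕ) (S : Finset ℂ) (a : ℂ) : ℂ[X] :=
  1 - (1 - ∏ b ∈ S.erase a, (C (a - b)⁻¹ * (X - C b)) ^ m) ^ m

theorem pow_dvd_one_sub_specPoly (m : ℕ) (S : Finset ℂ) (a : ℂ) :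
    (X - C a) ^ m ∣ 1 - specPoly m S a := by
  rw [specPoly, sub_sub_cancel]
  refine pow_dvd_pow_of_dvd (dvd_iff_isRoot.2 ?_) m
  rw [IsRoot.def, eval_sub, eval_one, eval_prod, Finset.prod_eq_one, sub_self]
  intro b hb
  have : a - b ≠ 0 := sub_ne_zero.2 (Finset.ne_of_mem_erase hb).symm
  simp [this]

theorem pow_dvd_specPoly (m : ℕ) {S : Finset ℂ} {a b : ℂ} (hb : b ∈ S) (hab : b ≠ a) :
    (X - C b) ^ m ∣ specPoly m S a := by
  set q : ℂ[X] := ∏ b ∈ S.erase a, (C (a - b)⁻¹ * (X - C b)) ^ m with hq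
  have h1 : (X - C b) ^ m ∣ q := by
    refine dvd_trans ?_ (Finset.dvd_prod_of_mem _ (Finset.mem_erase.2 ⟨hab, hb⟩))
    rw [mul_pow]
    exact dvd_mul_left _ _
  have h2 : q ∣ specPoly m S a := by
    have := sub_dvd_pow_sub_pow 1 (1 - q) m
    rwa [one_pow, sub_sub_cancel] at this
  exact h1.trans h2

/-- The finite set of eigenvalues of a matrix. -/
def spec (M : Matrix (Fin n) (Fin n) ℂ) : Finset ℂ := M.charpoly.roots.toFinset

theorem mem_spec {M : Matrix (Fin n) (Fin n) ℂ} {a : ℂ} : a ∈ spec M ↔ a ∈ eigenvalues M := by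
  rw [spec, Multiset.mem_toFinset, mem_roots (Matrix.charpoly_monic M).ne_zero,
    mem_eigenvalues_iff]

theorem coe_spec (M : Matrix (Fin n) (Fin n) ℂ) : (spec M : Set ℂ) = eigenvalues M :=
  Set.ext fun _ => mem_spec

theorem card_roots_charpoly (M : Matrix (Fin n) (Fin n) ℂ) :
    Multiset.card M.charpoly.roots = n := by
  rw [← (IsAlgClosed.splits M.charpoly).natDegree_eq_card_roots, Matrix.charpoly_natDegree_eq_dim,
    Fintype.card_fin]

theorem card_spec_le (M : Matrix (Fin n) (Fin n) ℂ) : (spec M).card ≤ n :=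
  (Multiset.toFinset_card_le _).trans_eq (card_roots_charpoly M)

theorem aeval_eq_zero_of_pow_dvd {M : Matrix (Fin n) (Fin n) ℂ} {p : ℂ[X]}
    (h : ∀ a ∈ spec M, (X - C a) ^ (n + 1) ∣ p) : aeval M p = 0 := by
  have h1 : ∏ a ∈ spec M, (X - C a) ^ (n + 1) ∣ p := by
    refine Finset.prod_dvd_of_coprime (fun a _ b _ hab => ?_) h
    exact (isCoprime_X_sub_C_of_isUnit_sub (sub_ne_zero.2 hab).isUnit).pow
  have h2 : M.charpoly ∣ ∏ a ∈ spec M, (X - C a) ^ (n + 1) := by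
    rw [(IsAlgClosed.splits M.charpoly).eq_prod_roots_of_monic (Matrix.charpoly_monic M),
      Finset.prod_multiset_map_count]
    refine Finset.prod_dvd_prod_of_dvd _ _ fun a _ => pow_dvd_pow _ ?_
    exact ((Multiset.count_le_card _ _).trans_eq (card_roots_charpoly M)).trans n.le_succ
  obtain ⟨q, hq⟩ := h2.trans h1
  rw [hq, map_mul, Matrix.aeval_self_charpoly, zero_mul]

/-- For `S = spec M` and `a ∈ S`, the projection to the generalized eigenspace of `M` for `a` along
the other generalized eigenspaces. -/
def specProj (S : Finset ℂ) (a : ℂ) (M : Matrix (Fin n) (Fin n) ℂ) : Matrix (Fin n) (Fin n) ℂ :=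
  aeval M (specPoly (n + 1) S a)

theorem commute_aeval (M : Matrix (Fin n) (Fin n) ℂ) (p q : ℂ[X]) :
    Commute (aeval M p) (aeval M q) :=
  (Commute.all p q).map (aeval M)

theorem commute_specProj (S : Finset ℂ) (a : ℂ) (M : Matrix (Fin n) (Fin n) ℂ) :
    Commute M (specProj S a M) := by
  have h := commute_aeval M X (specPoly (n + 1) S a)
  rwa [aeval_X] at h

theorem specProj_mul_self {M : Matrix (Fin n) (Fin n) ℂ} {a : ℂ} :
    specProj (spec M) a M * specProj (spec M) a M = specProj (spec M) a M := by
  have h : aeval M (specPoly (n + 1) (spec M) a * (1 - specPoly (n + 1) (spec M) a)) = 0 := by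
    refine aeval_eq_zero_of_pow_dvd fun b hb => ?_
    by_cases hab : b = a
    · rw [hab]; exact (pow_dvd_one_sub_specPoly _ _ _).mul_left _
    · exact (pow_dvd_specPoly _ hb hab).mul_right _
  rw [map_mul, map_sub, map_one, mul_sub, mul_one, sub_eq_zero] at h
  exact h.symm

theorem aeval_pow_mul_specProj (M : Matrix (Fin n) (Fin n) ℂ) (a : ℂ) :
    aeval M ((X - C a) ^ (n + 1)) * specProj (spec M) a M = 0 := by
  rw [specProj, ← map_mul]
  refine aeval_eq_zero_of_pow_dvd fun b hb => ?_
  by_cases hab : b = a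
  · rw [hab]; exact dvd_mul_right _ _
  · exact (pow_dvd_specPoly _ hb hab).mul_left _

theorem exists_aeval_pow_mul_eq (S : Finset ℂ) (M : Matrix (Fin n) (Fin n) ℂ) (a : ℂ) :
    ∃ Y, aeval M ((X - C a) ^ (n + 1)) * Y = 1 - specProj S a M := by
  obtain ⟨q, hq⟩ := pow_dvd_one_sub_specPoly (n + 1) S a
  exact ⟨aeval M q, by rw [← map_mul, ← hq, map_sub, map_one, specProj]⟩

/-- Combinations of the polynomials `specPoly` interpolate to high order. -/
theorem pow_dvd_sum_specPoly_sub (m : ℕ) (S : Finset ℂ) (c : ℂ → ℂ) {a : ℂ} (ha : a ∈ S) :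
    (X - C a) ^ m ∣ ∑ b ∈ S, C (c b) * specPoly m S b - C (c a) := by
  rw [← Finset.add_sum_erase _ _ ha]
  have e : C (c a) * specPoly m S a + ∑ b ∈ S.erase a, C (c b) * specPoly m S b - C (c a) =
      -(C (c a) * (1 - specPoly m S a)) + ∑ b ∈ S.erase a, C (c b) * specPoly m S b := by ring
  rw [e]
  refine dvd_add ((pow_dvd_one_sub_specPoly m S a).mul_left _).neg_right ?_
  exact Finset.dvd_sum fun b hb =>
    (pow_dvd_specPoly m ha (Finset.ne_of_mem_erase hb).symm).mul_left _

theorem sum_specProj (M : Matrix (Fin n) (Fin n) ℂ) :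
    ∑ a ∈ spec M, specProj (spec M) a M = 1 := by
  have h : aeval M (∑ b ∈ spec M, C (1 : ℂ) * specPoly (n + 1) (spec M) b - C 1) = 0 :=
    aeval_eq_zero_of_pow_dvd fun a ha => pow_dvd_sum_specPoly_sub _ _ (fun _ => 1) ha
  simp only [map_one, one_mul, map_sub, map_sum, sub_eq_zero] at h
  exact h

/-- The polynomial that yields the semisimple part of a matrix with set of eigenvalues `S`. -/
def semisimplePoly (m : ℕ) (S : Finset ℂ) : ℂ[X] := ∑ a ∈ S, C a * specPoly m S a

theorem aeval_semisimplePoly (S : Finset ℂ) (M : Matrix (Fin n) (Fin n) ℂ) :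
    aeval M (semisimplePoly (n + 1) S) = ∑ a ∈ S, a • specProj S a M := by
  simp [semisimplePoly, specProj, Algebra.smul_def]

theorem nilpotentPart_eq_aeval (M : Matrix (Fin n) (Fin n) ℂ) :
    nilpotentPart M = aeval M (X - semisimplePoly (n + 1) (spec M)) := by
  set s := semisimplePoly (n + 1) (spec M) with hs
  have hdvd : ∀ a ∈ spec M, (X - C a) ^ (n + 1) ∣ s - C a := fun a ha =>
    pow_dvd_sum_specPoly_sub _ _ (fun a => a) ha
  refine (isJordanChevalley_iff_nilpotentPart_eq M _).1 ⟨aeval M s, ?_, commute_aeval M _ _, ?_, ?_⟩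
  · rw [← map_add]; simp
  · refine Module.End.isSemisimple_of_squarefree_aeval_eq_zero
      (p := ∏ a ∈ spec M, (X - C a)) ?_ ?_
    · exact (separable_prod_X_sub_C_iff'.2 fun _ _ _ _ h => h).squarefree
    · have h1 : aeval (aeval M s) (∏ a ∈ spec M, (X - C a)) = 0 := by
        rw [← aeval_comp]
        refine aeval_eq_zero_of_pow_dvd fun a ha => ?_
        rw [prod_comp]
        refine (hdvd a ha).trans ?_
        have := Finset.dvd_prod_of_mem (fun a : ℂ => (X - C a).comp s) ha
        simpa using this
      have h2 := congrArg (Matrix.toLinAlgEquiv' (R := ℂ) (n := Fin n)) h1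
      rw [map_zero] at h2
      rw [← h2]
      exact aeval_algHom_apply (Matrix.toLinAlgEquiv' (R := ℂ) (n := Fin n)).toAlgHom _ _
  · refine ⟨n + 1, ?_⟩
    rw [← map_pow]
    refine aeval_eq_zero_of_pow_dvd fun a ha => pow_dvd_pow_of_dvd ?_ _
    have e : X - s = (X - C a) - (s - C a) := by ring
    rw [e]
    exact dvd_sub dvd_rfl ((dvd_pow_self _ n.succ_ne_zero).trans (hdvd a ha))

theorem nilpotentPart_eq_sub (M : Matrix (Fin n) (Fin n) ℂ) :
    nilpotentPart M = M - ∑ a ∈ spec M, a • specProj (spec M) a M := by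
  rw [nilpotentPart_eq_aeval, map_sub, aeval_X, aeval_semisimplePoly]

theorem eigenvalues_nilpotentPart {M : Matrix (Fin n) (Fin n) ℂ} {μ : ℂ}
    (hμ : μ ∈ eigenvalues (nilpotentPart M)) : μ = 0 := by
  obtain ⟨S, hS⟩ := (isJordanChevalley_iff_nilpotentPart_eq M _).2 rfl
  obtain ⟨k, hk⟩ := hS.isNilpotent
  obtain ⟨v, hv⟩ := Module.End.HasEigenvalue.exists_hasEigenvector hμ
  have h1 := hv.pow_apply k
  have h2 : (Matrix.toLin' (nilpotentPart M)) ^ k = 0 := by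
    have := (map_pow (Matrix.toLinAlgEquiv' (R := ℂ) (n := Fin n)) (nilpotentPart M) k).symm
    rw [hk, map_zero] at this
    exact this
  rw [h2, LinearMap.zero_apply] at h1
  exact eq_zero_of_pow_eq_zero ((smul_eq_zero.1 h1.symm).resolve_right hv.2)

/-! ### Quantitative estimates for spectral projections -/

/-- Scale invariant bounds on a matrix: eigenvalue gap at least `d`, eigenvalues of modulus at most
`A d`, Frobenius norm at most `c d`. -/
structure SpectralBounds (d A c : ℝ) (M : Matrix (Fin n) (Fin n) ℂ) : Prop where
  pos : 0 < d
  le_gap : ∀ a ∈ spec M, ∀ b ∈ spec M, a ≠ b → d ≤ ‖a - b‖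
  norm_eigenvalue_le : ∀ a ∈ spec M, ‖a‖ ≤ A * d
  norm_le : ‖M‖ ≤ c * d

theorem exists_norm_specProj_le (n : ℕ) (A c : ℝ) : ∃ B : ℝ, 0 ≤ B ∧
    ∀ (d : ℝ) (M : Matrix (Fin n) (Fin n) ℂ), SpectralBounds d A c M →
      ∀ a ∈ spec M, ‖specProj (spec M) a M‖ ≤ B := by
  set e : ℝ := ‖(1 : Matrix (Fin n) (Fin n) ℂ)‖ with he
  have he0 : 0 ≤ e := norm_nonneg _
  set K : ℝ := (|c| + |A| * e) ^ (n + 1) with hK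
  have hK0 : 0 ≤ K := by positivity
  refine ⟨e + (e + e * (1 + K) ^ n) ^ (n + 1), by positivity, fun d M h a ha => ?_⟩
  have hd := h.pos
  have hfac : ∀ b ∈ (spec M).erase a,
      ‖aeval M ((C (a - b)⁻¹ * (X - C b)) ^ (n + 1))‖ ≤ K := by
    intro b hb
    have hbS := Finset.mem_of_mem_erase hb
    have hgap := h.le_gap a ha b hbS (Finset.ne_of_mem_erase hb).symm
    rw [map_pow]
    refine (norm_pow_le' _ n.succ_pos).trans (pow_le_pow_left₀ (norm_nonneg _) ?_ _)
    have e1 : aeval M (C (a - b)⁻¹ * (X - C b)) = (a - b)⁻¹ • (M - b • 1) := by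
      simp [Algebra.smul_def]
    rw [e1, norm_smul, norm_inv]
    have h2 : ‖M - b • (1 : Matrix (Fin n) (Fin n) ℂ)‖ ≤ d * (|c| + |A| * e) := by
      refine (norm_sub_le _ _).trans ?_
      rw [norm_smul]
      have h3 := h.norm_le.trans (mul_le_mul_of_nonneg_right (le_abs_self c) hd.le)
      have h4 := (h.norm_eigenvalue_le b hbS).trans
        (mul_le_mul_of_nonneg_right (le_abs_self A) hd.le)
      have h5 := mul_le_mul_of_nonneg_right h4 he0
      linarith
    rw [inv_mul_le_iff₀ (hd.trans_le hgap)]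
    exact h2.trans (mul_le_mul_of_nonneg_right hgap (by positivity))
  have hprod : ∀ T ⊆ (spec M).erase a,
      ‖aeval M (∏ b ∈ T, (C (a - b)⁻¹ * (X - C b)) ^ (n + 1))‖ ≤ e * (1 + K) ^ T.card := by
    intro T
    induction T using Finset.induction_on with
    | empty => intro _; simp [he]
    | insert b T hb ih =>
      intro hT
      rw [Finset.prod_insert hb, map_mul, Finset.card_insert_of_notMem hb]
      refine (norm_mul_le _ _).trans ?_
      have h1 := hfac b (hT (Finset.mem_insert_self _ _))
      have h2 := ih ((Finset.subset_insert _ _).trans hT)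
      calc _ ≤ K * (e * (1 + K) ^ T.card) := by gcongr
        _ ≤ (1 + K) * (e * (1 + K) ^ T.card) := by gcongr; linarith
        _ = _ := by ring
  have hcard : ((spec M).erase a).card ≤ n := (Finset.card_erase_le).trans (card_spec_le M)
  have hq := (hprod _ Finset.Subset.rfl).trans (mul_le_mul_of_nonneg_left
    (pow_le_pow_right₀ (by linarith : 1 ≤ 1 + K) hcard) he0)
  rw [specProj, specPoly, map_sub, map_one, map_pow, map_sub, map_one]
  refine (norm_sub_le _ _).trans (add_le_add le_rfl ?_)
  refine (norm_pow_le' _ n.succ_pos).trans (pow_le_pow_left₀ (norm_nonneg _) ?_ _)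
  exact (norm_sub_le _ _).trans (add_le_add le_rfl hq)

/-- The failure of an idempotent `π` to be Hermitian is controlled by the component of `πᴴ` that
maps the kernel of `π` to its range. -/
theorem norm_idempotent_sub_conjTranspose_le {π : Matrix (Fin n) (Fin n) ℂ} (hπ : π * π = π) :
    ‖π - πᴴ‖ ≤ 2 * ‖π * πᴴ * (1 - π)‖ := by
  set X := π * πᴴ * (1 - π) with hX
  set E := π - π * πᴴ with hE
  have hπ' : πᴴ * πᴴ = πᴴ := by rw [← Matrix.conjTranspose_mul, hπ]
  have hr : ∀ Y, π * (π * Y) = π * Y := fun Y => by rw [← mul_assoc, hπ]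
  have hr' : ∀ Y, πᴴ * (πᴴ * Y) = πᴴ * Y := fun Y => by rw [← mul_assoc, hπ']
  have hEX : E * Xᴴ = -(E * Eᴴ) := by
    simp only [hE, hX, Matrix.conjTranspose_mul, Matrix.conjTranspose_sub,
      Matrix.conjTranspose_conjTranspose, Matrix.conjTranspose_one, sub_mul, mul_sub, one_mul,
      mul_assoc, hπ', hr, hr']
    abel
  have h1 : ‖E‖ ^ 2 ≤ ‖E‖ * ‖X‖ := by
    have h2 := norm_trace_mul_conjTranspose_le E X
    rw [hEX, Matrix.trace_neg, norm_neg, trace_mul_conjTranspose_self, Complex.norm_real,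
      Real.norm_of_nonneg (by positivity)] at h2
    exact h2
  have h3 : ‖E‖ ≤ ‖X‖ := by
    rcases (norm_nonneg E).eq_or_lt with h0 | h0
    · rw [← h0]; exact norm_nonneg _
    · exact le_of_mul_le_mul_left (by rwa [sq] at h1) h0
  have h4 : π - πᴴ = E - Eᴴ := by
    simp only [hE, Matrix.conjTranspose_sub, Matrix.conjTranspose_mul,
      Matrix.conjTranspose_conjTranspose]
    abel
  rw [h4]
  refine (norm_sub_le _ _).trans ?_
  rw [Matrix.frobenius_norm_conjTranspose]
  linarith

/-- Maps from a complement of a generalized eigenspace into it are eigenvectors of `ad M` only for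
differences of distinct eigenvalues of `M`. -/
theorem le_norm_of_commutator_eq_smul {M : Matrix (Fin n) (Fin n) ℂ} {d : ℝ}
    (hgap : ∀ a ∈ spec M, ∀ b ∈ spec M, a ≠ b → d ≤ ‖a - b‖) {a μ : ℂ} (ha : a ∈ spec M)
    {Z : Matrix (Fin n) (Fin n) ℂ} (hZ : Z ≠ 0)
    (hZπ : specProj (spec M) a M * Z * (1 - specProj (spec M) a M) = Z)
    (h : M * Z - Z * M = μ • Z) : d ≤ ‖μ‖ := by
  set π := specProj (spec M) a M with hπ
  have hππ : π * π = π := specProj_mul_self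
  have hπZ : π * Z = Z := by
    rw [← hZπ]; simp only [← mul_assoc, hππ]
  have hZπ' : Z * (1 - π) = Z := by
    conv_lhs => rw [← hπZ]
    exact hZπ
  have hstep : ∀ k, aeval M ((X - C a) ^ k) * Z = Z * aeval M ((X - C (a - μ)) ^ k) := by
    intro k
    induction k with
    | zero => simp
    | succ k ih =>
      rw [pow_succ', pow_succ, map_mul, map_mul, mul_assoc, ih, ← mul_assoc, ← mul_assoc]
      have h1 : aeval M (X - C a) * Z = Z * aeval M (X - C (a - μ)) := by
        have : M * Z = Z * M + μ • Z := by rw [← h]; abel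
        simp only [map_sub, aeval_X, aeval_C, sub_mul, mul_sub, this, Algebra.algebraMap_eq_smul_one,
          smul_mul_assoc, mul_smul_comm, one_mul, mul_one]
        abel
      rw [h1, mul_assoc, mul_assoc, (commute_aeval M _ _).eq]
  have hkill : Z * aeval M ((X - C (a - μ)) ^ (n + 1)) = 0 := by
    rw [← hstep, ← hπZ, ← mul_assoc, aeval_pow_mul_specProj, zero_mul]
  have hroot : a - μ ∈ spec M := by
    by_contra hnot
    have hu : IsUnit (aeval M (X - C (a - μ))) := by
      rw [mem_spec, eigenvalues, Set.mem_ofPred_eq, Module.End.hasEigenvalue_iff_mem_spectrum,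
        Matrix.spectrum_toLin', spectrum.mem_iff, not_not] at hnot
      rw [map_sub, aeval_X, aeval_C, ← neg_sub]
      exact hnot.neg
    rw [map_pow] at hkill
    exact hZ ((hu.pow (n + 1)).mul_left_eq_zero.1 hkill)
  by_cases h0 : a - μ = a
  · exfalso
    obtain ⟨Y, hY⟩ := exists_aeval_pow_mul_eq (spec M) M a
    apply hZ
    rw [← hZπ', ← hY, ← mul_assoc, ← h0, hkill, zero_mul]
  · have := hgap a ha _ hroot (Ne.symm h0)
    simpa using this

/-- A spectral projection that almost commutes with `Mᴴ` is almost Hermitian. -/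
theorem exists_norm_specProj_sub_conjTranspose_le (n : ℕ) (A c : ℝ) : ∃ K : ℝ, 0 < K ∧
    ∀ (d : ℝ) (M : Matrix (Fin n) (Fin n) ℂ), SpectralBounds d A c M → ∀ a ∈ spec M,
      d * ‖specProj (spec M) a M - (specProj (spec M) a M)ᴴ‖ ≤
        K * ‖Mᴴ * specProj (spec M) a M - specProj (spec M) a M * Mᴴ‖ := by
  obtain ⟨B, hB0, hB⟩ := exists_norm_specProj_le n A c
  set e : ℝ := ‖(1 : Matrix (Fin n) (Fin n) ℂ)‖ with he
  have he0 : 0 ≤ e := norm_nonneg _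
  set q : ℝ := (1 + 2 * (2 * |c|)) ^ Module.finrank ℂ (Matrix (Fin n) (Fin n) ℂ) with hq
  have hq0 : 0 ≤ q := by positivity
  refine ⟨2 * q * B * (e + B) + 1, by positivity, fun d M h a ha => ?_⟩
  have hd := h.pos
  set π := specProj (spec M) a M with hπ
  have hππ : π * π = π := specProj_mul_self
  have hπB : ‖π‖ ≤ B := hB d M h a ha
  have hcomm : M * π = π * M := commute_specProj _ _ _
  have hcomm' : M * (1 - π) = (1 - π) * M := by rw [mul_sub, sub_mul, hcomm, mul_one, one_mul]
  set ad : Matrix (Fin n) (Fin n) ℂ →ₗ[ℂ] Matrix (Fin n) (Fin n) ℂ :=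
    LinearMap.mulLeft ℂ M - LinearMap.mulRight ℂ M with had
  have had' : ∀ X, ad X = M * X - X * M := fun X => rfl
  set P : Matrix (Fin n) (Fin n) ℂ →ₗ[ℂ] Matrix (Fin n) (Fin n) ℂ :=
    LinearMap.mulRight ℂ (1 - π) ∘ₗ LinearMap.mulLeft ℂ π with hP
  have hP' : ∀ X, P X = π * X * (1 - π) := fun X => rfl
  have hadP : ∀ X, ad (P X) = P (ad X) := by
    intro X
    have h1 : M * (π * X * (1 - π)) = π * (M * X) * (1 - π) := by
      rw [← mul_assoc, ← mul_assoc, hcomm]; simp only [mul_assoc]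
    have h2 : π * X * (1 - π) * M = π * (X * M) * (1 - π) := by
      rw [mul_assoc (π * X), ← hcomm']; simp only [mul_assoc]
    rw [had', had', hP', hP', h1, h2, mul_sub π, sub_mul]
  set W : Submodule ℂ (Matrix (Fin n) (Fin n) ℂ) := LinearMap.eqLocus P LinearMap.id with hW
  have hadW : ∀ X ∈ W, ad X ∈ W := by
    intro X hX
    rw [hW, LinearMap.mem_eqLocus, LinearMap.id_apply] at hX ⊢
    rw [← hadP, hX]
  have hX : π * πᴴ * (1 - π) ∈ W := by
    rw [hW, LinearMap.mem_eqLocus, LinearMap.id_apply, hP']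
    have h1 : (1 - π) * (1 - π) = 1 - π := by
      simp [mul_sub, sub_mul, hππ]
    simp only [← mul_assoc, hππ]
    rw [mul_assoc (π * πᴴ), h1]
  have key := norm_le_of_hasEigenvalue (ad.restrict hadW) hd (c := 2 * |c|) (by positivity)
    (fun X => ?_) (fun μ hμ => ?_) ⟨_, hX⟩
  · have h1 : ‖π * πᴴ * (1 - π)‖ ≤ q / d * ‖ad (π * πᴴ * (1 - π))‖ := by
      refine le_trans key ?_
      refine mul_le_mul_of_nonneg_right ?_ (norm_nonneg _)
      refine div_le_div_of_nonneg_right ?_ hd.le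
      exact pow_le_pow_right₀ (by linarith [abs_nonneg c]) (Submodule.finrank_le W)
    have h2 : ad (π * πᴴ * (1 - π)) = -(π * (Mᴴ * π - π * Mᴴ)ᴴ * (1 - π)) := by
      have := hadP πᴴ
      rw [hP', hP', had' πᴴ] at this
      rw [this]
      simp only [Matrix.conjTranspose_sub, Matrix.conjTranspose_mul,
        Matrix.conjTranspose_conjTranspose, mul_sub, sub_mul, mul_one]
      abel
    have h3 : ‖ad (π * πᴴ * (1 - π))‖ ≤ B * ‖Mᴴ * π - π * Mᴴ‖ * (e + B) := by
      rw [h2, norm_neg]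
      refine (norm_mul_le _ _).trans ?_
      refine mul_le_mul ((norm_mul_le _ _).trans ?_) ((norm_sub_le _ _).trans ?_)
        (norm_nonneg _) (by positivity)
      · rw [Matrix.frobenius_norm_conjTranspose]
        exact mul_le_mul_of_nonneg_right hπB (norm_nonneg _)
      · exact add_le_add le_rfl hπB
    have h4 := norm_idempotent_sub_conjTranspose_le hππ
    have h5 : d * ‖π * πᴴ * (1 - π)‖ ≤ q * (B * ‖Mᴴ * π - π * Mᴴ‖ * (e + B)) := by
      have h6 := mul_le_mul_of_nonneg_left h1 hd.le
      have e1 : d * (q / d * ‖ad (π * πᴴ * (1 - π))‖) = q * ‖ad (π * πᴴ * (1 - π))‖ := by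
        field_simp
      rw [e1] at h6
      exact h6.trans (mul_le_mul_of_nonneg_left h3 hq0)
    have h7 := mul_le_mul_of_nonneg_left h4 hd.le
    have h8 := norm_nonneg (Mᴴ * π - π * Mᴴ)
    nlinarith
  · change ‖ad (X : Matrix (Fin n) (Fin n) ℂ)‖ ≤ 2 * |c| * d * ‖(X : Matrix (Fin n) (Fin n) ℂ)‖
    rw [had']
    have hM := h.norm_le.trans (mul_le_mul_of_nonneg_right (le_abs_self c) hd.le)
    have h1 := norm_mul_le M (X : Matrix (Fin n) (Fin n) ℂ)
    have h2 := norm_mul_le (X : Matrix (Fin n) (Fin n) ℂ) M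
    have h3 := mul_le_mul_of_nonneg_right hM (norm_nonneg (X : Matrix (Fin n) (Fin n) ℂ))
    refine (norm_sub_le _ _).trans ?_
    linarith
  · obtain ⟨Z, hZ⟩ := hμ.exists_hasEigenvector
    have h1 : ad (Z : Matrix (Fin n) (Fin n) ℂ) = μ • (Z : Matrix (Fin n) (Fin n) ℂ) :=
      congrArg Subtype.val hZ.apply_eq_smul
    refine le_norm_of_commutator_eq_smul h.le_gap ha (Z := Z) (fun h0 => hZ.2 (Subtype.ext h0)) ?_
      (by rw [← had', h1])
    exact Z.2

/-- The excess of the norms of the spectral projections over those of Hermitian projections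
measures how far they are from being Hermitian. -/
theorem sum_norm_specProj_sq_sub (M : Matrix (Fin n) (Fin n) ℂ) :
    ∑ a ∈ spec M, ‖specProj (spec M) a M‖ ^ 2 - n =
      ∑ a ∈ spec M, ‖specProj (spec M) a M - (specProj (spec M) a M)ᴴ‖ ^ 2 / 2 := by
  have h1 : ∀ a, ‖specProj (spec M) a M - (specProj (spec M) a M)ᴴ‖ ^ 2 / 2 =
      ‖specProj (spec M) a M‖ ^ 2 - (specProj (spec M) a M).trace.re := by
    intro a
    set π := specProj (spec M) a M
    have hππ : π * π = π := specProj_mul_self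
    have hπ' : πᴴ * πᴴ = πᴴ := by rw [← Matrix.conjTranspose_mul, hππ]
    have h2 := trace_mul_conjTranspose_self (π - πᴴ)
    rw [Matrix.conjTranspose_sub, Matrix.conjTranspose_conjTranspose, sub_mul, mul_sub, mul_sub,
      hππ, hπ', Matrix.trace_sub, Matrix.trace_sub, Matrix.trace_sub, Matrix.trace_mul_comm πᴴ π,
      trace_mul_conjTranspose_self, Matrix.trace_conjTranspose] at h2
    have h3 := congrArg Complex.re h2
    simp only [Complex.sub_re, Complex.ofReal_re, Complex.star_def, Complex.conj_re] at h3
    linarith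
  rw [Finset.sum_congr rfl fun a _ => h1 a, Finset.sum_sub_distrib, ← Complex.re_sum,
    ← Matrix.trace_sum, sum_specProj]
  simp

/-- If the spectral projections of `M` are almost Hermitian, then `Mᴴ` and the adjoint of the
nilpotent part of `M` have almost the same commutator with any polynomial in `M`. -/
theorem norm_commutator_sub_le {M : Matrix (Fin n) (Fin n) ℂ} {d A c D : ℝ}
    (h : SpectralBounds d A c M)
    (hD : ∀ a ∈ spec M, d ^ 2 * ‖specProj (spec M) a M - (specProj (spec M) a M)ᴴ‖ ≤ D)
    (y : ℂ[X]) :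
    d * ‖(Mᴴ * aeval M y - aeval M y * Mᴴ) -
      ((nilpotentPart M)ᴴ * aeval M y - aeval M y * (nilpotentPart M)ᴴ)‖ ≤
        2 * n * |A| * |D| * ‖aeval M y‖ := by
  have hd := h.pos
  set Y := aeval M y with hY
  set π := fun a => specProj (spec M) a M with hπ
  have e1 : (Mᴴ * Y - Y * Mᴴ) - ((nilpotentPart M)ᴴ * Y - Y * (nilpotentPart M)ᴴ) =
      ∑ a ∈ spec M, star a • (Y * (π a - (π a)ᴴ) - (π a - (π a)ᴴ) * Y) := by
    have h1 : ∀ a, star a • (Y * (π a - (π a)ᴴ) - (π a - (π a)ᴴ) * Y) =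
        (star a • (π a)ᴴ) * Y - Y * (star a • (π a)ᴴ) := by
      intro a
      have h2 : π a * Y = Y * π a := commute_aeval M _ _
      simp only [mul_sub, sub_mul, h2, smul_mul_assoc, mul_smul_comm, smul_sub]
      abel
    rw [Finset.sum_congr rfl fun a _ => h1 a, Finset.sum_sub_distrib, ← Finset.sum_mul,
      ← Finset.mul_sum, nilpotentPart_eq_sub, Matrix.conjTranspose_sub, Matrix.conjTranspose_sum]
    simp only [Matrix.conjTranspose_smul, sub_mul, mul_sub, hπ]
    abel
  rw [e1]
  have h2 : ∀ a ∈ spec M, d * ‖star a • (Y * (π a - (π a)ᴴ) - (π a - (π a)ᴴ) * Y)‖ ≤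
      2 * |A| * |D| * ‖Y‖ := by
    intro a ha
    rw [norm_smul, norm_star]
    have h3 : ‖Y * (π a - (π a)ᴴ) - (π a - (π a)ᴴ) * Y‖ ≤ 2 * ‖π a - (π a)ᴴ‖ * ‖Y‖ := by
      refine (norm_sub_le _ _).trans ?_
      have h4 := norm_mul_le Y (π a - (π a)ᴴ)
      have h5 := norm_mul_le (π a - (π a)ᴴ) Y
      linarith
    have h4 : ‖a‖ ≤ |A| * d := (h.norm_eigenvalue_le a ha).trans
      (mul_le_mul_of_nonneg_right (le_abs_self A) hd.le)
    have h5 : d ^ 2 * ‖π a - (π a)ᴴ‖ ≤ |D| := (hD a ha).trans (le_abs_self D)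
    calc d * (‖a‖ * ‖Y * (π a - (π a)ᴴ) - (π a - (π a)ᴴ) * Y‖)
        ≤ d * ((|A| * d) * (2 * ‖π a - (π a)ᴴ‖ * ‖Y‖)) := by gcongr
      _ = 2 * |A| * ‖Y‖ * (d ^ 2 * ‖π a - (π a)ᴴ‖) := by ring
      _ ≤ 2 * |A| * ‖Y‖ * |D| := by gcongr
      _ = _ := by ring
  have h6 := mul_le_mul_of_nonneg_left (norm_sum_le (spec M)
    fun a => star a • (Y * (π a - (π a)ᴴ) - (π a - (π a)ᴴ) * Y)) hd.le
  refine h6.trans ?_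
  rw [Finset.mul_sum]
  refine (Finset.sum_le_card_nsmul _ _ _ h2).trans ?_
  rw [nsmul_eq_mul]
  have h7 : ((spec M).card : ℝ) ≤ n := by exact_mod_cast card_spec_le M
  calc _ ≤ (n : ℝ) * (2 * |A| * |D| * ‖Y‖) := by gcongr
    _ = _ := by ring

end Higgs

namespace Higgs

open Polynomial Filter Topology

variable {n : ℕ}

/-! ### Holomorphic dependence of the roots of a polynomial -/

theorem tendsto_eval_of_coeff {q : ℂ → ℂ[X]} {N : ℕ} {z a : ℂ}
    (hdeg : ∀ᶠ w in 𝓝 z, (q w).natDegree < N)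
    (hcoeff : ∀ k, ContinuousAt (fun w => (q w).coeff k) z) :
    Tendsto (fun y : ℂ × ℂ => (q y.1).eval y.2) (𝓝 z ×ˢ 𝓝 a) (𝓝 ((q z).eval a)) := by
  rw [eval_eq_sum_range' hdeg.self_of_nhds]
  have h : Tendsto (fun y : ℂ × ℂ => ∑ i ∈ Finset.range N, (q y.1).coeff i * y.2 ^ i)
      (𝓝 z ×ˢ 𝓝 a) (𝓝 (∑ i ∈ Finset.range N, (q z).coeff i * a ^ i)) :=
    tendsto_finsetSum _ fun i _ =>
      ((hcoeff i).tendsto.comp tendsto_fst).mul (tendsto_snd.pow i)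
  refine h.congr' ?_
  filter_upwards [tendsto_fst.eventually hdeg] with y hy
  rw [eval_eq_sum_range' hy]

/-- A continuous choice of simple roots of polynomials with holomorphic coefficients is
holomorphic. -/
theorem differentiableAt_of_eval_eq_zero {q : ℂ → ℂ[X]} {β : ℂ → ℂ} {N : ℕ} {z : ℂ}
    (hdeg : ∀ᶠ w in 𝓝 z, (q w).natDegree < N)
    (hcoeff : ∀ k, DifferentiableAt ℂ (fun w => (q w).coeff k) z) (hβ : ContinuousAt β z)
    (hroot : ∀ᶠ w in 𝓝 z, (q w).eval (β w) = 0)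
    (hsimple : (derivative (q z)).eval (β z) ≠ 0) : DifferentiableAt ℂ β z := by
  set b := β z with hb
  set s : ℂ → ℂ := fun w => dslope (fun x => (q z).eval x) b (β w) with hs
  have hsz : Tendsto s (𝓝 z) (𝓝 ((derivative (q z)).eval b)) := by
    have h1 : ContinuousAt (dslope (fun x => (q z).eval x) b) b :=
      continuousAt_dslope_same.2 (q z).differentiable.differentiableAt
    have h2 : dslope (fun x => (q z).eval x) b b = (derivative (q z)).eval b := by
      rw [dslope_same, Polynomial.deriv]
    rw [← h2]
    exact h1.tendsto.comp hβ
  have hnum : Tendsto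
      (fun w => -∑ i ∈ Finset.range N, slope (fun w => (q w).coeff i) z w * β w ^ i)
      (𝓝[≠] z) (𝓝 (-∑ i ∈ Finset.range N, deriv (fun w => (q w).coeff i) z * b ^ i)) := by
    refine (tendsto_finsetSum _ fun i _ => ?_).neg
    exact (hasDerivAt_iff_tendsto_slope.1 (hcoeff i).hasDerivAt).mul
      ((hβ.tendsto.mono_left nhdsWithin_le_nhds).pow i)
  have hlim := hnum.div (hsz.mono_left nhdsWithin_le_nhds) hsimple
  refine HasDerivAt.differentiableAt (hasDerivAt_iff_tendsto_slope.2 (hlim.congr' ?_))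
  have hs0 : ∀ᶠ w in 𝓝[≠] z, s w ≠ 0 :=
    (hsz.mono_left nhdsWithin_le_nhds).eventually_ne hsimple
  filter_upwards [hs0, hdeg.filter_mono nhdsWithin_le_nhds,
    hroot.filter_mono nhdsWithin_le_nhds, self_mem_nhdsWithin] with w h1 h2 h3 h4
  have hwz : w - z ≠ 0 := sub_ne_zero.2 h4
  have e1 : (β w - b) * s w = (q z).eval (β w) - (q z).eval b :=
    sub_smul_dslope (fun x => (q z).eval x) b (β w)
  have e2 : ∑ i ∈ Finset.range N, slope (fun w => (q w).coeff i) z w * β w ^ i =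
      (w - z)⁻¹ * ((q w).eval (β w) - (q z).eval (β w)) := by
    rw [eval_eq_sum_range' h2, eval_eq_sum_range' hdeg.self_of_nhds, ← Finset.sum_sub_distrib,
      Finset.mul_sum]
    refine Finset.sum_congr rfl fun i _ => ?_
    rw [slope_def_field]
    ring
  rw [hroot.self_of_nhds] at e1
  simp only [Pi.div_apply]
  rw [e2, h3, slope_def_field]
  field_simp
  linear_combination -e1

/-- A family of monic polynomials of degree `n` with holomorphic coefficients over an open set `U`,
whose number of distinct roots is constant and whose distinct roots have distance at least `d`. -/
structure IsSeparatedFamily (n : ℕ) (d B : ℝ) (U : Set ℂ) (p : ℂ → ℂ[X]) : Prop where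
  isOpen : IsOpen U
  pos : 0 < d
  monic : ∀ w ∈ U, (p w).Monic
  natDegree_eq : ∀ w ∈ U, (p w).natDegree = n
  coeff : ∀ k, DifferentiableOn ℂ (fun w => (p w).coeff k) U
  le_gap : ∀ w ∈ U, ∀ a ∈ (p w).roots.toFinset, ∀ b ∈ (p w).roots.toFinset, a ≠ b → d ≤ ‖a - b‖
  card_eq : ∀ w ∈ U, ∀ v ∈ U, (p w).roots.toFinset.card = (p v).roots.toFinset.card
  norm_le : ∀ w ∈ U, ∀ a ∈ (p w).roots.toFinset, ‖a‖ ≤ B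

namespace IsSeparatedFamily

variable {d B : ℝ} {U : Set ℂ} {p : ℂ → ℂ[X]} {z : ℂ}

theorem mem_nhds (h : IsSeparatedFamily n d B U p) (hz : z ∈ U) : U ∈ 𝓝 z := h.isOpen.mem_nhds hz

theorem differentiableAt_coeff (h : IsSeparatedFamily n d B U p) (hz : z ∈ U) (k : ℕ) :
    DifferentiableAt ℂ (fun w => (p w).coeff k) z :=
  (h.coeff k).differentiableAt (h.mem_nhds hz)

theorem mem_roots (h : IsSeparatedFamily n d B U p) (hz : z ∈ U) {x : ℂ} :
    x ∈ (p z).roots.toFinset ↔ (p z).eval x = 0 := by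
  rw [Multiset.mem_toFinset, Polynomial.mem_roots (h.monic z hz).ne_zero, IsRoot.def]

theorem sum_rootMultiplicity (h : IsSeparatedFamily n d B U p) (hz : z ∈ U) :
    ∑ a ∈ (p z).roots.toFinset, (p z).rootMultiplicity a = n := by
  simp only [← count_roots]
  rw [Multiset.toFinset_sum_count_eq, ← (IsAlgClosed.splits (p z)).natDegree_eq_card_roots,
    h.natDegree_eq z hz]

/-- Roots of nearby polynomials are near roots. -/
theorem eventually_exists_near (h : IsSeparatedFamily n d B U p) (hz : z ∈ U) {ε : ℝ}
    (hε : 0 < ε) : ∀ᶠ w in 𝓝 z, ∀ x ∈ (p w).roots.toFinset,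
      ∃ a ∈ (p z).roots.toFinset, ‖x - a‖ < ε := by
  have hlim : Tendsto (fun w => ∑ k ∈ Finset.range (n + 1),
      ‖(p z).coeff k - (p w).coeff k‖ * |B| ^ k) (𝓝 z) (𝓝 0) := by
    have : Tendsto (fun w => ∑ k ∈ Finset.range (n + 1),
      ‖(p z).coeff k - (p w).coeff k‖ * |B| ^ k) (𝓝 z)
        (𝓝 (∑ k ∈ Finset.range (n + 1), ‖(p z).coeff k - (p z).coeff k‖ * |B| ^ k)) :=
      tendsto_finsetSum _ fun k _ => Tendsto.mul_const _
        (tendsto_const_nhds.sub (h.differentiableAt_coeff hz k).continuousAt.tendsto).norm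
    simpa using this
  filter_upwards [hlim.eventually_lt_const (pow_pos hε n), h.mem_nhds hz] with w hw hwU x hx
  by_contra! hfar
  have hxB : ‖x‖ ≤ |B| := (h.norm_le w hwU x hx).trans (le_abs_self B)
  have h0 : (p w).eval x = 0 := (h.mem_roots hwU).1 hx
  have h1 : ‖(p z).eval x‖ < ε ^ n := by
    refine lt_of_le_of_lt ?_ hw
    have e : (p z).eval x =
        ∑ k ∈ Finset.range (n + 1), ((p z).coeff k - (p w).coeff k) * x ^ k := by
      rw [← sub_zero ((p z).eval x), ← h0,
        eval_eq_sum_range' (n := n + 1) (by rw [h.natDegree_eq z hz]; omega),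
        eval_eq_sum_range' (n := n + 1) (by rw [h.natDegree_eq w hwU]; omega),
        ← Finset.sum_sub_distrib]
      exact Finset.sum_congr rfl fun k _ => by ring
    rw [e]
    refine (norm_sum_le _ _).trans (Finset.sum_le_sum fun k _ => ?_)
    rw [norm_mul, norm_pow]
    gcongr
  have h2 : ε ^ n ≤ ‖(p z).eval x‖ := by
    rw [(IsAlgClosed.splits (p z)).eq_prod_roots_of_monic (h.monic z hz),
      Finset.prod_multiset_map_count, eval_prod, norm_prod]
    have h3 : ∀ a ∈ (p z).roots.toFinset, ε ^ (p z).roots.count a ≤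
        ‖eval x ((X - C a) ^ (p z).roots.count a)‖ := by
      intro a ha
      rw [eval_pow, norm_pow, eval_sub, eval_X, eval_C]
      exact pow_le_pow_left₀ hε.le (hfar a ha) _
    refine le_trans (le_of_eq ?_) (Finset.prod_le_prod (fun a _ => by positivity) h3)
    rw [Finset.prod_pow_eq_pow_sum]
    congr 1
    simp only [count_roots]
    exact (h.sum_rootMultiplicity hz).symm
  linarith

/-- Near `z`, every root of `p z` is close to a root of `p w`, because the number of roots is
constant. -/
theorem eventually_exists_root (h : IsSeparatedFamily n d B U p) (hz : z ∈ U) {ε : ℝ}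
    (hε : 0 < ε) : ∀ᶠ w in 𝓝 z, ∀ a ∈ (p z).roots.toFinset,
      ∃ x ∈ (p w).roots.toFinset, ‖x - a‖ < ε := by
  have hε' : 0 < min ε (d / 2) := lt_min hε (by linarith [h.pos])
  filter_upwards [h.eventually_exists_near hz hε', h.mem_nhds hz] with w hw hwU a ha
  choose! φ hφ hφ' using hw
  have hinj : Set.InjOn φ (p w).roots.toFinset := by
    intro x hx y hy hxy
    by_contra hne
    have h1 := h.le_gap w hwU x hx y hy hne
    have h2 := (hφ' x hx).trans_le (min_le_right _ _)
    have h3 := (hφ' y hy).trans_le (min_le_right _ _)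
    rw [hxy] at h2
    have h4 : ‖x - y‖ ≤ ‖x - φ y‖ + ‖y - φ y‖ := by
      have : x - y = (x - φ y) - (y - φ y) := by ring
      rw [this]; exact norm_sub_le _ _
    linarith
  obtain ⟨x, hx, hxa⟩ := Finset.surjOn_of_injOn_of_card_le φ hφ hinj
    (h.card_eq z hz w hwU).le ha
  exact ⟨x, hx, hxa ▸ (hφ' x hx).trans_le (min_le_left _ _)⟩

theorem eventually_rootMultiplicity_le (h : IsSeparatedFamily n d B U p) (hz : z ∈ U) (a : ℂ) :
    ∀ᶠ y : ℂ × ℂ in 𝓝 z ×ˢ 𝓝 a,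
      (p y.1).rootMultiplicity y.2 ≤ (p z).rootMultiplicity a := by
  set m := (p z).rootMultiplicity a with hm
  have hne : (derivative^[m] (p z)).eval a ≠ 0 := by
    rw [hm, eval_iterate_derivative_rootMultiplicity]
    exact smul_ne_zero (Nat.factorial_ne_zero _)
      (eval_divByMonic_pow_rootMultiplicity_ne_zero a (h.monic z hz).ne_zero)
  have ht := tendsto_eval_of_coeff (q := fun w => derivative^[m] (p w)) (N := n + 1) (z := z)
    (a := a) ?_ ?_
  · filter_upwards [ht.eventually_ne hne] with y hy
    by_contra! hlt
    exact hy (isRoot_iterate_derivative_of_lt_rootMultiplicity hlt)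
  · filter_upwards [h.mem_nhds hz] with w hw
    have := natDegree_iterate_derivative (p w) m
    rw [h.natDegree_eq w hw] at this
    omega
  · intro k
    simp only [coeff_iterate_derivative]
    exact (h.differentiableAt_coeff hz (k + m)).continuousAt.const_smul _

/-- Multiplicities of roots are locally constant, since they are upper semicontinuous and their sum
is constant. -/
theorem eventually_rootMultiplicity_eq (h : IsSeparatedFamily n d B U p) (hz : z ∈ U) :
    ∃ δ > 0, ∀ᶠ w in 𝓝 z, ∀ a ∈ (p z).roots.toFinset, ∀ x ∈ (p w).roots.toFinset, ‖x - a‖ < δ →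
      (p w).rootMultiplicity x = (p z).rootMultiplicity a := by
  have h1 : ∀ a ∈ (p z).roots.toFinset, ∀ᶠ δ : ℝ in 𝓝[>] 0, ∀ᶠ w in 𝓝 z, ∀ x, ‖x - a‖ < δ →
      (p w).rootMultiplicity x ≤ (p z).rootMultiplicity a := by
    intro a _
    obtain ⟨P, hP, Q, hQ, hPQ⟩ := eventually_prod_iff.1 (h.eventually_rootMultiplicity_le hz a)
    obtain ⟨δ₀, hδ₀, hball⟩ := Metric.eventually_nhds_iff.1 hQ
    filter_upwards [Ioo_mem_nhdsGT hδ₀] with δ hδ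
    filter_upwards [hP] with w hw x hx
    exact hPQ hw (hball (by rw [dist_eq_norm]; exact hx.trans hδ.2))
  obtain ⟨δ₀, hδ₀, hδ₀pos⟩ :=
    (((eventually_all_finset _).2 h1).and self_mem_nhdsWithin).exists
  have hδ₀pos : 0 < δ₀ := hδ₀pos
  set δ := min δ₀ (d / 2) with hδ
  have hδpos : 0 < δ := lt_min hδ₀pos (by linarith [h.pos])
  refine ⟨δ, hδpos, ?_⟩
  filter_upwards [(eventually_all_finset _).2 hδ₀, h.eventually_exists_root hz hδpos,
    h.mem_nhds hz] with w hle hex hwU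
  choose! ψ hψ hψ' using hex
  have huniq : ∀ a ∈ (p z).roots.toFinset, ∀ x ∈ (p w).roots.toFinset, ‖x - a‖ < δ → x = ψ a := by
    intro a ha x hx hxa
    by_contra hne
    have h2 := h.le_gap w hwU x hx (ψ a) (hψ a ha) hne
    have h3 := hxa.trans_le (min_le_right _ _)
    have h4 := (hψ' a ha).trans_le (min_le_right _ _)
    have h5 : ‖x - ψ a‖ ≤ ‖x - a‖ + ‖ψ a - a‖ := by
      have : x - ψ a = (x - a) - (ψ a - a) := by ring
      rw [this]; exact norm_sub_le _ _
    linarith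
  have hinj : Set.InjOn ψ (p z).roots.toFinset := by
    intro a ha b hb hab
    by_contra hne
    have h2 := h.le_gap z hz a ha b hb hne
    have h3 := (hψ' a ha).trans_le (min_le_right _ _)
    have h4 := (hψ' b hb).trans_le (min_le_right _ _)
    rw [hab] at h3
    have h5 : ‖a - b‖ ≤ ‖ψ b - a‖ + ‖ψ b - b‖ := by
      have : a - b = (ψ b - b) - (ψ b - a) := by ring
      rw [this]; exact (norm_sub_le _ _).trans_eq (add_comm _ _)
    linarith
  have himg : (p z).roots.toFinset.image ψ = (p w).roots.toFinset :=
    Finset.eq_of_subset_of_card_le (Finset.image_subset_iff.2 hψ)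
      (by rw [Finset.card_image_of_injOn hinj]; exact (h.card_eq w hwU z hz).le)
  have hsum : ∑ a ∈ (p z).roots.toFinset, (p w).rootMultiplicity (ψ a) =
      ∑ a ∈ (p z).roots.toFinset, (p z).rootMultiplicity a := by
    rw [← Finset.sum_image (f := fun x => (p w).rootMultiplicity x) hinj, himg,
      h.sum_rootMultiplicity hwU, h.sum_rootMultiplicity hz]
  have heq := (Finset.sum_eq_sum_iff_of_le fun a ha =>
    hle a ha (ψ a) ((hψ' a ha).trans_le (min_le_left _ _))).1 hsum
  intro a ha x hx hxa
  rw [huniq a ha x hx hxa]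
  exact heq a ha

theorem differentiableAt_of_root (h : IsSeparatedFamily n d B U p) (hz : z ∈ U) {β : ℂ → ℂ}
    (hβ : ∀ᶠ w in 𝓝 z, β w ∈ (p w).roots.toFinset ∧ ‖β w - β z‖ ≤ d / 2) :
    DifferentiableAt ℂ β z := by
  have hd := h.pos
  have hβz : β z ∈ (p z).roots.toFinset := hβ.self_of_nhds.1
  have hcont : ContinuousAt β z := by
    rw [Metric.continuousAt_iff']
    intro ε hε
    have hε' : 0 < min ε (d / 2) := lt_min hε (by linarith)
    filter_upwards [h.eventually_exists_near hz hε', hβ] with w hw hβw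
    obtain ⟨a, ha, hwa⟩ := hw _ hβw.1
    have hab : a = β z := by
      by_contra hne
      have h1 := h.le_gap z hz a ha _ hβz hne
      have h2 := hwa.trans_le (min_le_right _ _)
      have h3 : ‖a - β z‖ ≤ ‖β w - β z‖ + ‖β w - a‖ := by
        have : a - β z = (β w - β z) - (β w - a) := by ring
        rw [this]; exact norm_sub_le _ _
      linarith [hβw.2]
    rw [dist_eq_norm, ← hab]
    exact hwa.trans_le (min_le_left _ _)
  obtain ⟨δ, hδ, hmult⟩ := h.eventually_rootMultiplicity_eq hz
  set m := (p z).rootMultiplicity (β z) with hm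
  have hm0 : 0 < m := by
    rw [hm, rootMultiplicity_pos (h.monic z hz).ne_zero]
    exact (h.mem_roots hz).1 hβz
  -- after `m - 1` derivatives the root becomes simple
  refine differentiableAt_of_eval_eq_zero (q := fun w => derivative^[m - 1] (p w)) (N := n + 1)
    ?_ ?_ hcont ?_ ?_
  · filter_upwards [h.mem_nhds hz] with w hw
    have := natDegree_iterate_derivative (p w) (m - 1)
    rw [h.natDegree_eq w hw] at this
    omega
  · intro k
    simp only [coeff_iterate_derivative]
    exact (h.differentiableAt_coeff hz (k + (m - 1))).fun_const_smul _
  · have hnear : ∀ᶠ w in 𝓝 z, ‖β w - β z‖ < δ := by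
      filter_upwards [hcont.eventually (Metric.ball_mem_nhds _ hδ)] with w hw
      rwa [← dist_eq_norm]
    filter_upwards [hmult, hβ, hnear] with w h1 h2 h3
    refine isRoot_iterate_derivative_of_lt_rootMultiplicity ?_
    rw [h1 _ hβz _ h2.1 h3]
    omega
  · rw [← Function.iterate_succ_apply' derivative, show (m - 1).succ = m by omega, hm,
      eval_iterate_derivative_rootMultiplicity]
    exact smul_ne_zero (Nat.factorial_ne_zero _)
      (eval_divByMonic_pow_rootMultiplicity_ne_zero _ (h.monic z hz).ne_zero)

/-- The distinct roots are locally the values of holomorphic functions. -/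
theorem exists_holomorphic_roots (h : IsSeparatedFamily n d B U p) (hz : z ∈ U) :
    ∃ α : ℂ → ℂ → ℂ, ∀ᶠ w in 𝓝 z,
      (p w).roots.toFinset = (p z).roots.toFinset.image (fun a => α a w) ∧
      Set.InjOn (fun a => α a w) (p z).roots.toFinset ∧
      ∀ a ∈ (p z).roots.toFinset, DifferentiableAt ℂ (α a) w := by
  have hd := h.pos
  have hex : ∀ a w, ∃ x, (∃ y ∈ (p w).roots.toFinset, ‖y - a‖ < d / 4) →
      x ∈ (p w).roots.toFinset ∧ ‖x - a‖ < d / 4 := by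
    intro a w
    by_cases hy : ∃ y ∈ (p w).roots.toFinset, ‖y - a‖ < d / 4
    · exact ⟨hy.choose, fun _ => hy.choose_spec⟩
    · exact ⟨0, fun hy' => absurd hy' hy⟩
  choose α hα using hex
  refine ⟨α, ?_⟩
  have hroot := h.eventually_exists_root hz (ε := d / 4) (by linarith)
  filter_upwards [eventually_eventually_nhds.2 hroot, h.mem_nhds hz] with w hev hwU
  have hw : ∀ a ∈ (p z).roots.toFinset, α a w ∈ (p w).roots.toFinset ∧ ‖α a w - a‖ < d / 4 :=
    fun a ha => hα a w (hev.self_of_nhds a ha)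
  have hinj : Set.InjOn (fun a => α a w) (p z).roots.toFinset := by
    intro a ha b hb hab
    have hab : α a w = α b w := hab
    by_contra hne
    have h2 := h.le_gap z hz a ha b hb hne
    have h3 := (hw a ha).2
    have h4 := (hw b hb).2
    rw [hab] at h3
    have h5 : ‖a - b‖ ≤ ‖α b w - b‖ + ‖α b w - a‖ := by
      have : a - b = (α b w - b) - (α b w - a) := by ring
      rw [this]; exact norm_sub_le _ _
    linarith
  refine ⟨?_, hinj, fun a ha => ?_⟩
  · refine (Finset.eq_of_subset_of_card_le
      (Finset.image_subset_iff.2 fun a ha => (hw a ha).1) ?_).symm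
    rw [Finset.card_image_of_injOn hinj]
    exact (h.card_eq w hwU z hz).le
  · refine h.differentiableAt_of_root hwU ?_
    filter_upwards [hev] with v hv
    have h1 := hα a v (hv a ha)
    refine ⟨h1.1, ?_⟩
    have h2 : α a v - α a w = (α a v - a) - (α a w - a) := by ring
    rw [h2]
    refine (norm_sub_le _ _).trans ?_
    linarith [h1.2, (hw a ha).2]

end IsSeparatedFamily

/-! ### Holomorphic dependence of spectral projections -/

/-- The matrix valued function `M` is holomorphic at `z`, entrywise. -/
def MatHolomorphicAt (M : ℂ → Matrix (Fin n) (Fin n) ℂ) (z : ℂ) : Prop :=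
  ∀ i j, DifferentiableAt ℂ (fun w => M w i j) z

namespace MatHolomorphicAt

variable {M N : ℂ → Matrix (Fin n) (Fin n) ℂ} {z : ℂ}

theorem const (A : Matrix (Fin n) (Fin n) ℂ) (z : ℂ) : MatHolomorphicAt (fun _ => A) z :=
  fun _ _ => differentiableAt_const _

theorem sub (hM : MatHolomorphicAt M z) (hN : MatHolomorphicAt N z) :
    MatHolomorphicAt (fun w => M w - N w) z := fun i j => (hM i j).fun_sub (hN i j)

theorem smul {c : ℂ → ℂ} (hc : DifferentiableAt ℂ c z) (hM : MatHolomorphicAt M z) :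
    MatHolomorphicAt (fun w => c w • M w) z := fun i j => hc.fun_mul (hM i j)

theorem mul (hM : MatHolomorphicAt M z) (hN : MatHolomorphicAt N z) :
    MatHolomorphicAt (fun w => M w * N w) z := by
  intro i j
  simp only [Matrix.mul_apply]
  exact DifferentiableAt.fun_sum fun k _ => (hM i k).fun_mul (hN k j)

theorem pow (hM : MatHolomorphicAt M z) (k : ℕ) : MatHolomorphicAt (fun w => M w ^ k) z := by
  induction k with
  | zero => simpa using const 1 z
  | succ k ih => simpa only [pow_succ] using ih.mul hM

theorem sum {ι : Type*} {s : Finset ι} {M : ι → ℂ → Matrix (Fin n) (Fin n) ℂ}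
    (hM : ∀ i ∈ s, MatHolomorphicAt (M i) z) : MatHolomorphicAt (fun w => ∑ i ∈ s, M i w) z := by
  intro i j
  simp only [Matrix.sum_apply]
  exact DifferentiableAt.fun_sum fun k hk => hM k hk i j

theorem congr_of_eventuallyEq (hM : MatHolomorphicAt M z) (h : N =ᶠ[𝓝 z] M) :
    MatHolomorphicAt N z := fun i j =>
  (hM i j).congr_of_eventuallyEq (h.mono fun w hw => by simp only [hw])

theorem aeval_prod {ι : Type*} {s : Finset ι} {c β : ι → ℂ → ℂ} (m : ℕ)
    (hM : MatHolomorphicAt M z) (hc : ∀ i ∈ s, DifferentiableAt ℂ (c i) z)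
    (hβ : ∀ i ∈ s, DifferentiableAt ℂ (β i) z) :
    MatHolomorphicAt (fun w => aeval (M w) (∏ i ∈ s, (C (c i w) * (X - C (β i w))) ^ m)) z := by
  classical
  induction s using Finset.induction_on with
  | empty => simpa using const 1 z
  | insert i s hi ih =>
    simp only [Finset.prod_insert hi, map_mul, map_pow]
    refine mul (pow ?_ m) ?_
    · have h1 : MatHolomorphicAt (fun w => c i w • (M w - β i w • 1)) z :=
        smul (hc i (Finset.mem_insert_self _ _))
          (hM.sub (smul (hβ i (Finset.mem_insert_self _ _)) (const 1 z)))
      simpa [Algebra.algebraMap_eq_smul_one] using h1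
    · simpa only [map_mul, map_pow] using
        ih (fun j hj => hc j (Finset.mem_insert_of_mem hj))
          (fun j hj => hβ j (Finset.mem_insert_of_mem hj))

theorem specProj {S : Finset ℂ} {α : ℂ → ℂ → ℂ} {a : ℂ} (hM : MatHolomorphicAt M z)
    (hα : ∀ b ∈ S, DifferentiableAt ℂ (α b) z)
    (hinj : ∀ᶠ w in 𝓝 z, Set.InjOn (fun b => α b w) S) (ha : a ∈ S) :
    MatHolomorphicAt (fun w => specProj (S.image fun b => α b w) (α a w) (M w)) z := by
  have hc : ∀ b ∈ S.erase a, DifferentiableAt ℂ (fun w => (α a w - α b w)⁻¹) z := by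
    intro b hb
    refine ((hα a ha).fun_sub (hα b (Finset.mem_of_mem_erase hb))).fun_inv (sub_ne_zero.2 ?_)
    exact fun h => Finset.ne_of_mem_erase hb
      (hinj.self_of_nhds (Finset.mem_of_mem_erase hb) ha h.symm)
  have h1 := ((const 1 z).sub (((const 1 z).sub (aeval_prod (n + 1) hM hc
    fun b hb => hα b (Finset.mem_of_mem_erase hb))).pow (n + 1)))
  refine h1.congr_of_eventuallyEq ?_
  filter_upwards [hinj] with w hw
  have he : (S.image fun b => α b w).erase (α a w) = (S.erase a).image fun b => α b w := by
    ext x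
    simp only [Finset.mem_erase, Finset.mem_image]
    constructor
    · rintro ⟨hx, b, hb, rfl⟩
      exact ⟨b, ⟨fun h => hx (by rw [h]), hb⟩, rfl⟩
    · rintro ⟨b, ⟨hba, hb⟩, rfl⟩
      exact ⟨fun h => hba (hw hb ha h), b, hb, rfl⟩
  rw [Higgs.specProj, specPoly, he, Finset.prod_image fun x hx y hy hxy =>
    hw (Finset.mem_of_mem_erase hx) (Finset.mem_of_mem_erase hy) hxy]
  simp only [map_sub, map_one, map_pow]

end MatHolomorphicAt

theorem differentiableAt_charpoly_coeff {M : ℂ → Matrix (Fin n) (Fin n) ℂ} {z : ℂ}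
    (hM : MatHolomorphicAt M z) (k : ℕ) :
    DifferentiableAt ℂ (fun w => (M w).charpoly.coeff k) z := by
  have e : ∀ w, (M w).charpoly.coeff k = MvPolynomial.eval₂ (RingHom.id ℂ)
      (fun ij : Fin n × Fin n => M w ij.1 ij.2) ((Matrix.charpoly.univ ℂ (Fin n)).coeff k) :=
    fun w => (Matrix.charpoly.univ_coeff_eval₂Hom (Fin n) (RingHom.id ℂ)
      (fun ij : Fin n × Fin n => M w ij.1 ij.2) k).symm
  simp only [e]
  induction (Matrix.charpoly.univ ℂ (Fin n)).coeff k using MvPolynomial.induction_on with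
  | C a => simp
  | add p q hp hq => simpa only [MvPolynomial.eval₂_add] using hp.fun_add hq
  | mul_X p i hp =>
    simpa only [MvPolynomial.eval₂_mul, MvPolynomial.eval₂_X] using hp.fun_mul (hM i.1 i.2)

section MemS

variable {d A : ℝ} {f : ℂ → Matrix (Fin n) (Fin n) ℂ} {z : ℂ}

theorem MemS.matHolomorphicAt (hf : MemS n d A f) (hz : z ∈ disk 1) : MatHolomorphicAt f z :=
  fun i j => (hf.isHiggsField i j).differentiableAt (Metric.isOpen_ball.mem_nhds hz)

theorem MemS.isSeparatedFamily (hf : MemS n d A f) (hd : 0 < d) :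
    IsSeparatedFamily n d (A * d) (disk 1) fun w => (f w).charpoly where
  isOpen := Metric.isOpen_ball
  pos := hd
  monic w _ := Matrix.charpoly_monic _
  natDegree_eq w _ := by rw [Matrix.charpoly_natDegree_eq_dim, Fintype.card_fin]
  coeff k w hw :=
    (differentiableAt_charpoly_coeff (hf.matHolomorphicAt hw) k).differentiableWithinAt
  le_gap w hw a ha b hb := hf.le_gap w hw a (mem_spec.1 ha) b (mem_spec.1 hb)
  card_eq := by
    have h : ∀ w ∈ disk 1, ∀ v ∈ disk 1, (spec (f v)).card ≤ (spec (f w)).card := by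
      intro w hw v hv
      by_contra! hlt
      have : w ∈ criticalSet f := by
        refine ⟨hw, v, hv, ?_⟩
        rwa [numGenEigenspaces, numGenEigenspaces, ← coe_spec, ← coe_spec, Set.ncard_coe_finset,
          Set.ncard_coe_finset]
      rw [hf.criticalSet_eq_empty] at this
      exact this
    exact fun w hw v hv => le_antisymm (h v hv w hw) (h w hw v hv)
  norm_le w hw a ha := hf.norm_eigenvalue_le w hw a (mem_spec.1 ha)

theorem MemS.exists_holomorphic_eigenvalues (hf : MemS n d A f) (hd : 0 < d) (hz : z ∈ disk 1) :
    ∃ α : ℂ → ℂ → ℂ, ∀ᶠ w in 𝓝 z, spec (f w) = (spec (f z)).image (fun a => α a w) ∧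
      Set.InjOn (fun a => α a w) (spec (f z)) ∧
      ∀ a ∈ spec (f z), DifferentiableAt ℂ (α a) w :=
  (hf.isSeparatedFamily hd).exists_holomorphic_roots hz

theorem MemS.matHolomorphicAt_nilpotentPart (hf : MemS n d A f) (hd : 0 < d) (hz : z ∈ disk 1) :
    MatHolomorphicAt (fun w => nilpotentPart (f w)) z := by
  obtain ⟨α, hα⟩ := hf.exists_holomorphic_eigenvalues hd hz
  have h1 := hα.self_of_nhds.2.2
  have h2 : MatHolomorphicAt (fun w => f w - ∑ a ∈ spec (f z),
      α a w • specProj ((spec (f z)).image fun b => α b w) (α a w) (f w)) z :=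
    (hf.matHolomorphicAt hz).sub (.sum fun a ha => .smul (h1 a ha)
      (.specProj (hf.matHolomorphicAt hz) h1 (hα.mono fun w hw => hw.2.1) ha))
  refine h2.congr_of_eventuallyEq (hα.mono fun w hw => ?_)
  simp only
  rw [nilpotentPart_eq_sub, hw.1, Finset.sum_image hw.2.1]

end MemS

end Higgs

namespace Higgs

open scoped Matrix.Norms.Frobenius
open Polynomial Filter Topology

variable {n : ℕ}

/-! ### Polynomials of a matrix in a unitary frame -/

section inFrame

variable {P : Matrix (Fin n) (Fin n) ℂ}

theorem charpoly_inFrame (hP : IsUnit P.det) (M : Matrix (Fin n) (Fin n) ℂ) :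
    (inFrame P M).charpoly = M.charpoly := by
  rw [inFrame, Matrix.charpoly_mul_comm, Matrix.nonsing_inv_mul_cancel_left _ _ hP]

theorem spec_inFrame (hP : IsUnit P.det) (M : Matrix (Fin n) (Fin n) ℂ) :
    spec (inFrame P M) = spec M := by
  rw [spec, spec, charpoly_inFrame hP]

theorem aeval_inFrame (hP : IsUnit P.det) (M : Matrix (Fin n) (Fin n) ℂ) (p : ℂ[X]) :
    aeval (inFrame P M) p = inFrame P (aeval M p) := by
  have hC : ∀ a : ℂ, algebraMap ℂ (Matrix (Fin n) (Fin n) ℂ) a =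
      inFrame P (algebraMap ℂ (Matrix (Fin n) (Fin n) ℂ) a) := fun a => by
    rw [inFrame, ← Algebra.commutes, mul_assoc, Matrix.mul_nonsing_inv _ hP, mul_one]
  induction p using Polynomial.induction_on with
  | C a => rw [aeval_C, aeval_C]; exact hC a
  | add p q hp hq => rw [map_add, map_add, hp, hq]; simp only [inFrame, mul_add, add_mul]
  | monomial k a h =>
    rw [pow_succ, ← mul_assoc, map_mul _ (C a * X ^ k), map_mul _ (C a * X ^ k), h, aeval_X,
      aeval_X, inFrame_mul hP]

theorem specProj_inFrame (hP : IsUnit P.det) (S : Finset ℂ) (a : ℂ)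
    (M : Matrix (Fin n) (Fin n) ℂ) : specProj S a (inFrame P M) = inFrame P (specProj S a M) :=
  aeval_inFrame hP M _

theorem nilpotentPart_inFrame (hP : IsUnit P.det) (M : Matrix (Fin n) (Fin n) ℂ) :
    nilpotentPart (inFrame P M) = inFrame P (nilpotentPart M) := by
  rw [nilpotentPart_eq_aeval, nilpotentPart_eq_aeval, spec_inFrame hP, aeval_inFrame hP]

theorem hNorm_commutator (hP : IsUnit P.det) (M Y : Matrix (Fin n) (Fin n) ℂ) :
    hNorm (Pᴴ * P) (hAdjoint (Pᴴ * P) M * Y - Y * hAdjoint (Pᴴ * P) M) =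
      ‖(inFrame P M)ᴴ * inFrame P Y - inFrame P Y * (inFrame P M)ᴴ‖ := by
  rw [hNorm_eq_norm_inFrame hP, inFrame_sub, inFrame_mul hP, inFrame_mul hP, inFrame_hAdjoint hP]

end inFrame

/-! ### The maximum principle for sections commuting with the Higgs field -/

section

variable {f H : ℂ → Matrix (Fin n) (Fin n) ℂ}

theorem continuousAt_of_hasWirtingerAt {ρ : ℂ → ℝ} {p q z : ℂ}
    (h : HasWirtingerAt (fun w => (ρ w : ℂ)) p q z) : ContinuousAt ρ z := by
  have h1 := Complex.continuous_re.continuousAt.comp (HasFDerivAt.continuousAt h)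
  exact h1

theorem sub_sq_norm_mem {R : ℝ} (hR₁ : R < 1) {z : ℂ} (hz : z ∈ disk R) :
    0 < R ^ 2 - ‖z‖ ^ 2 ∧ R ^ 2 - ‖z‖ ^ 2 ≤ 1 := by
  have h1 : ‖z‖ < R := by simpa using hz
  have h2 := norm_nonneg z
  constructor <;> nlinarith

theorem le_div_of_barrier {r R x C : ℝ} (hr : 0 < r) (hrR : r < R) {z : ℂ}
    (hz : z ∈ disk r) (hx : 0 ≤ x) (h : x * (R ^ 2 - ‖z‖ ^ 2) ^ 4 ≤ C) :
    x ≤ C / (R ^ 2 - r ^ 2) ^ 4 := by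
  have h1 : ‖z‖ < r := by simpa using hz
  have h2 := norm_nonneg z
  have h3 : 0 < R ^ 2 - r ^ 2 := by nlinarith
  have h4 : R ^ 2 - r ^ 2 ≤ R ^ 2 - ‖z‖ ^ 2 := by nlinarith
  rw [le_div_iff₀ (by positivity)]
  refine le_trans ?_ h
  gcongr

/-- An Ahlfors type estimate: a holomorphic endomorphism `s` that commutes with the Higgs field `f`
and for which `|[f*, s]|` dominates `|s|²` as soon as `|s|` is large is bounded on smaller disks. -/
theorem IsHarmonicMetric.hNorm_sq_le (hH : IsHarmonicMetric f H)
    {s : ℂ → Matrix (Fin n) (Fin n) ℂ} {r R T ε : ℝ} (hr : 0 < r) (hrR : r < R) (hR₁ : R < 1)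
    (hT : 0 ≤ T) (hε : 0 < ε) (hs : ∀ z ∈ disk 1, MatHolomorphicAt s z)
    (hcomm : ∀ z ∈ disk 1, Commute (f z) (s z))
    (hdom : ∀ z ∈ disk R, T ≤ hNorm (H z) (s z) ^ 2 → ε * hNorm (H z) (s z) ^ 2 ≤
      hNorm (H z) (hAdjoint (H z) (f z) * s z - s z * hAdjoint (H z) (f z)))
    {z : ℂ} (hz : z ∈ disk r) :
    hNorm (H z) (s z) ^ 2 ≤ (T + 4 / ε ^ 2) / (R ^ 2 - r ^ 2) ^ 4 := by
  have hev : ∀ z ∈ disk 1, ∀ᶠ w in 𝓝 z, ∀ i j, DifferentiableAt ℂ (fun w => s w i j) w :=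
    fun z hz => Filter.mem_of_superset (Metric.isOpen_ball.mem_nhds hz) hs
  have hcont : ContinuousOn (fun z => hNorm (H z) (s z) ^ 2) (disk 1) := by
    intro w hw
    obtain ⟨p, q, a, b, h1, -⟩ := hH.bochner hw (hev w hw) (hcomm w hw)
    exact (continuousAt_of_hasWirtingerAt h1.self_of_nhds).continuousWithinAt
  obtain ⟨x, hx, hmax, hbar⟩ := exists_barrier_max (hr.trans hrR) hR₁ hcont
    fun w _ => by positivity
  have hx1 : x ∈ disk 1 := Metric.ball_subset_ball hR₁.le hx
  obtain ⟨p, q, a, b, h1, h2, -, h4⟩ := hH.bochner hx1 (hev x hx1) (hcomm x hx1)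
  obtain ⟨-, h6⟩ := hbar p q a b h1 h2
  obtain ⟨hk0, hk1⟩ := sub_sq_norm_mem hR₁ hx
  set k := R ^ 2 - ‖x‖ ^ 2
  set ρ := hNorm (H x) (s x) ^ 2 with hρ
  set e := hNorm (H x) (hAdjoint (H x) (f x) * s x - s x * hAdjoint (H x) (f x)) with he
  have hρ0 : 0 ≤ ρ := by positivity
  have hε2 : 0 < ε ^ 2 := by positivity
  have key : ρ * k ^ 4 ≤ T + 4 / ε ^ 2 := by
    have hk4 : k ^ 4 ≤ k ^ 2 := pow_le_pow_of_le_one hk0.le hk1 (by norm_num)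
    have hk2 : k ^ 2 ≤ 1 := pow_le_one₀ hk0.le hk1
    by_cases hTρ : T ≤ ρ
    · have h7 : (ε * ρ) ^ 2 ≤ e ^ 2 := pow_le_pow_left₀ (by positivity) (hdom x hx hTρ) 2
      have h8 : k ^ 2 * (ρ * (ε * ρ) ^ 2) ≤ 4 * ρ ^ 2 := by
        refine le_trans ?_ h6
        refine mul_le_mul_of_nonneg_left ?_ (by positivity)
        exact (mul_le_mul_of_nonneg_left h7 hρ0).trans h4
      have h9 : ρ * k ^ 2 ≤ 4 / ε ^ 2 := by
        rcases hρ0.eq_or_lt with h0 | h0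
        · rw [← h0, zero_mul]; positivity
        · rw [le_div_iff₀ hε2]
          refine le_of_mul_le_mul_left ?_ (by positivity : 0 < ρ ^ 2)
          linarith
      have h10 := mul_le_mul_of_nonneg_left hk4 hρ0
      linarith
    · have h7 : ρ * k ^ 4 ≤ ρ * 1 := mul_le_mul_of_nonneg_left (hk4.trans hk2) hρ0
      have : 0 < 4 / ε ^ 2 := by positivity
      linarith
  exact le_div_of_barrier hr hrR hz (by positivity)
    ((hmax z (Metric.ball_subset_ball hrR.le hz)).trans key)

end

/-! ### The bound for the Higgs field -/

/-- The Higgs field is bounded by a multiple of `d`. -/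
theorem exists_hNorm_higgs_le (n : ℕ) (A : ℝ) {d₀ r R : ℝ} (hd₀ : 0 < d₀) (hr : 0 < r)
    (hrR : r < R) (hR₁ : R < 1) :
    ∃ c : ℝ, ∀ d, d₀ ≤ d → ∀ f H : ℂ → Matrix (Fin n) (Fin n) ℂ,
      MemS n d A f → IsHarmonicMetric f H → ∀ z ∈ disk r, hNorm (H z) (f z) ≤ c * d := by
  set ε : ℝ := 1 / (2 * (n ^ 2 + 1)) with hε
  have hε0 : 0 < ε := by positivity
  have hk : 0 < R ^ 2 - r ^ 2 := by nlinarith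
  set C : ℝ := (2 * n * A ^ 2 + 4 / ε ^ 2 / d₀ ^ 2) / (R ^ 2 - r ^ 2) ^ 4 with hC
  have hC0 : 0 ≤ C := by positivity
  refine ⟨Real.sqrt C, fun d hd f H hf hH z hz => ?_⟩
  have hd0 : 0 < d := hd₀.trans_le hd
  have h := hH.hNorm_sq_le (s := f) (T := 2 * n * (A * d) ^ 2) hr hrR hR₁ (by positivity) hε0
    (fun z hz => hf.matHolomorphicAt hz) (fun z _ => Commute.refl _) (fun w hw hT => ?_) hz
  · refine (abs_le_of_sq_le_sq' ?_ (by positivity)).2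
    rw [mul_pow, Real.sq_sqrt hC0]
    refine h.trans ?_
    rw [hC, div_mul_eq_mul_div]
    refine div_le_div_of_nonneg_right ?_ (by positivity)
    have h1 : 4 / ε ^ 2 ≤ 4 / ε ^ 2 / d₀ ^ 2 * d ^ 2 := by
      rw [div_mul_eq_mul_div, le_div_iff₀ (by positivity)]
      gcongr
    have h2 : 2 * n * (A * d) ^ 2 = 2 * n * A ^ 2 * d ^ 2 := by ring
    linarith
  · have hw1 : w ∈ disk 1 := Metric.ball_subset_ball hR₁.le hw
    obtain ⟨P, hP, hHP⟩ := exists_frame (hH.isHermitianMetric.posDef w hw1)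
    rw [hHP] at hT ⊢
    rw [hNorm_commutator hP]
    rw [hNorm_eq_norm_inFrame hP] at hT ⊢
    set M := inFrame P (f w) with hM
    have h1 : ‖M‖ ^ 2 ≤ n * (A * d) ^ 2 + n ^ 2 * ‖M * Mᴴ - Mᴴ * M‖ := by
      refine norm_sq_le_of_eigenvalues fun μ hμ => hf.norm_eigenvalue_le w hw1 μ ?_
      rwa [← mem_spec, hM, spec_inFrame hP, mem_spec] at hμ
    rw [norm_sub_rev] at h1
    have h2 := norm_nonneg (Mᴴ * M - M * Mᴴ)
    rw [hε, one_div, inv_mul_le_iff₀ (by positivity)]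
    nlinarith

/-! ### Asymptotic orthogonality of the generalized eigenspaces -/

/-- The excess of the squared norms of the spectral projections of `f` over their sum for an
orthogonal decomposition into generalized eigenspaces. -/
def excess (f H : ℂ → Matrix (Fin n) (Fin n) ℂ) (z : ℂ) : ℝ :=
  ∑ a ∈ spec (f z), hNorm (H z) (specProj (spec (f z)) a (f z)) ^ 2 - n

theorem excess_eq {f H : ℂ → Matrix (Fin n) (Fin n) ℂ} {z : ℂ} {P : Matrix (Fin n) (Fin n) ℂ}
    (hP : IsUnit P.det) (hHP : H z = Pᴴ * P) :
    excess f H z = ∑ a ∈ spec (inFrame P (f z)),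
      ‖specProj (spec (inFrame P (f z))) a (inFrame P (f z)) -
        (specProj (spec (inFrame P (f z))) a (inFrame P (f z)))ᴴ‖ ^ 2 / 2 := by
  rw [← sum_norm_specProj_sq_sub, excess, hHP, spec_inFrame hP]
  simp only [hNorm_eq_norm_inFrame hP, specProj_inFrame hP]

theorem excess_nonneg {f H : ℂ → Matrix (Fin n) (Fin n) ℂ} (hH : IsHermitianMetric H) {z : ℂ}
    (hz : z ∈ disk 1) : 0 ≤ excess f H z := by
  obtain ⟨P, hP, hHP⟩ := exists_frame (hH.posDef z hz)
  rw [excess_eq hP hHP]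
  exact Finset.sum_nonneg fun _ _ => by positivity

/-- The spectral projections are locally holomorphic endomorphisms commuting with `f`, so the
Bochner inequality applies to each of them. -/
theorem excess_bochner {d A : ℝ} {f H : ℂ → Matrix (Fin n) (Fin n) ℂ} (hf : MemS n d A f)
    (hd : 0 < d) (hH : IsHarmonicMetric f H) {z : ℂ} (hz : z ∈ disk 1) :
    ∃ p q : ℂ → ℂ, ∃ a b : ℂ,
      (∀ᶠ w in 𝓝 z, HasWirtingerAt (fun w => (excess f H w : ℂ)) (p w) (q w) w) ∧
      HasWirtingerAt p a b z ∧
      ∑ a ∈ spec (f z), hNorm (H z) (hAdjoint (H z) (f z) * specProj (spec (f z)) a (f z) -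
        specProj (spec (f z)) a (f z) * hAdjoint (H z) (f z)) ^ 2 ≤ b.re := by
  obtain ⟨α, hα⟩ := hf.exists_holomorphic_eigenvalues hd hz
  set S := spec (f z) with hS
  set s : ℂ → ℂ → Matrix (Fin n) (Fin n) ℂ :=
    fun a w => specProj (S.image fun b => α b w) (α a w) (f w) with hs
  have hsz : ∀ a ∈ S, ∀ᶠ w in 𝓝 z, ∀ i j, DifferentiableAt ℂ (fun w => s a w i j) w := by
    intro a ha
    filter_upwards [eventually_eventually_nhds.2 hα, Metric.isOpen_ball.mem_nhds hz] with w hw hw1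
    exact MatHolomorphicAt.specProj (hf.matHolomorphicAt hw1) hw.self_of_nhds.2.2
      (hw.mono fun v hv => hv.2.1) ha
  have hB : ∀ a ∈ S, ∃ p q : ℂ → ℂ, ∃ a' b : ℂ,
      (∀ᶠ w in 𝓝 z, HasWirtingerAt (fun w => ((hNorm (H w) (s a w) ^ 2 : ℝ) : ℂ)) (p w) (q w) w) ∧
      HasWirtingerAt p a' b z ∧
      hNorm (H z) (hAdjoint (H z) (f z) * s a z - s a z * hAdjoint (H z) (f z)) ^ 2 ≤ b.re := by
    intro a ha
    obtain ⟨p, q, a', b, h1, h2, h3, -⟩ :=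
      hH.bochner hz (hsz a ha) (commute_specProj _ _ _)
    exact ⟨p, q, a', b, h1, h2, h3⟩
  choose! p q a' b h1 h2 h3 using hB
  have hloc : ∀ᶠ w in 𝓝 z, excess f H w = ∑ a ∈ S, hNorm (H w) (s a w) ^ 2 - n := by
    filter_upwards [hα] with w hw
    rw [excess, hw.1, Finset.sum_image hw.2.1]
  refine ⟨fun w => ∑ a ∈ S, p a w, fun w => ∑ a ∈ S, q a w, ∑ a ∈ S, a' a, ∑ a ∈ S, b a,
    ?_, .sum h2, ?_⟩
  · filter_upwards [eventually_eventually_nhds.2 hloc, (eventually_all_finset _).2 h1]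
      with w hw hw1
    have h4 := (HasWirtingerAt.sum hw1).sub (.const (n : ℂ) w)
    simp only [sub_zero] at h4
    refine h4.congr_of_eventuallyEq (hw.mono fun v hv => ?_)
    simp only [hv]
    push_cast
    rfl
  · rw [Complex.re_sum]
    have hαz := hα.self_of_nhds
    have h5 : ∑ a ∈ S, hNorm (H z) (hAdjoint (H z) (f z) * s a z -
        s a z * hAdjoint (H z) (f z)) ^ 2 ≤ ∑ a ∈ S, (b a).re := Finset.sum_le_sum h3
    refine le_trans (le_of_eq ?_) h5
    have himg : S.image (fun a => α a z) = S := hαz.1.symm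
    simp only [hs, himg]
    set G : ℂ → ℝ := fun a => hNorm (H z) (hAdjoint (H z) (f z) * specProj S a (f z) -
      specProj S a (f z) * hAdjoint (H z) (f z)) ^ 2
    calc ∑ a ∈ S, G a = ∑ a ∈ S.image (fun a => α a z), G a := by rw [himg]
      _ = _ := Finset.sum_image hαz.2.1

theorem MemS.spectralBounds {d A c : ℝ} {f H : ℂ → Matrix (Fin n) (Fin n) ℂ} (hf : MemS n d A f)
    (hd : 0 < d) {z : ℂ} (hz : z ∈ disk 1) {P : Matrix (Fin n) (Fin n) ℂ} (hP : IsUnit P.det)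
    (hHP : H z = Pᴴ * P) (hc : hNorm (H z) (f z) ≤ c * d) :
    SpectralBounds d A c (inFrame P (f z)) where
  pos := hd
  le_gap a ha b hb := by
    rw [spec_inFrame hP, mem_spec] at ha hb
    exact hf.le_gap z hz a ha b hb
  norm_eigenvalue_le a ha := by
    rw [spec_inFrame hP, mem_spec] at ha
    exact hf.norm_eigenvalue_le z hz a ha
  norm_le := by rwa [hHP, hNorm_eq_norm_inFrame hP] at hc

/-- The excess decays like `d⁻⁴`. -/
theorem exists_excess_le (n : ℕ) (A c : ℝ) {r R : ℝ} (hr : 0 < r) (hrR : r < R) (hR₁ : R < 1) :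
    ∃ D : ℝ, ∀ d, 0 < d → ∀ f H : ℂ → Matrix (Fin n) (Fin n) ℂ,
      MemS n d A f → IsHarmonicMetric f H → (∀ z ∈ disk R, hNorm (H z) (f z) ≤ c * d) →
      ∀ z ∈ disk r, d ^ 4 * excess f H z ≤ D := by
  obtain ⟨B, hB0, hB⟩ := exists_norm_specProj_le n A c
  obtain ⟨K, hK0, hK⟩ := exists_norm_specProj_sub_conjTranspose_le n A c
  refine ⟨n * B ^ 2 * (10 * K ^ 2) ^ 2 / (R ^ 2 - r ^ 2) ^ 4, fun d hd f H hf hH hc z hz => ?_⟩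
  have hcont : ContinuousOn (excess f H) (disk 1) := by
    intro w hw
    obtain ⟨p, q, a, b, h1, -⟩ := excess_bochner hf hd hH hw
    exact (continuousAt_of_hasWirtingerAt h1.self_of_nhds).continuousWithinAt
  obtain ⟨x, hx, hmax, hbar⟩ := exists_barrier_max (hr.trans hrR) hR₁ hcont
    fun w hw => excess_nonneg hH.isHermitianMetric hw
  have hx1 : x ∈ disk 1 := Metric.ball_subset_ball hR₁.le hx
  have hu0 : 0 ≤ excess f H x := excess_nonneg hH.isHermitianMetric hx1
  obtain ⟨p, q, a, b, h1, h2, h3⟩ := excess_bochner hf hd hH hx1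
  obtain ⟨h4, -⟩ := hbar p q a b h1 h2
  obtain ⟨hk0, -⟩ := sub_sq_norm_mem hR₁ hx
  obtain ⟨P, hP, hHP⟩ := exists_frame (hH.isHermitianMetric.posDef x hx1)
  have hsb := hf.spectralBounds hd hx1 hP hHP (hc x hx)
  have hu := excess_eq (f := f) hP hHP
  have hu' : excess f H x ≤ n * B ^ 2 := by
    rw [hu, ← sum_norm_specProj_sq_sub]
    have h5 := Finset.sum_le_card_nsmul _ _ (B ^ 2) fun a ha =>
      pow_le_pow_left₀ (norm_nonneg _) (hB d _ hsb a ha) 2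
    rw [nsmul_eq_mul] at h5
    have h6 : ((spec (inFrame P (f x))).card : ℝ) ≤ n := by exact_mod_cast card_spec_le _
    have h7 := mul_le_mul_of_nonneg_right h6 (sq_nonneg B)
    have h8 : (0 : ℝ) ≤ n := n.cast_nonneg
    linarith
  have hlow : 2 * d ^ 2 * excess f H x ≤ K ^ 2 * b.re := by
    have h5 : 2 * d ^ 2 * excess f H x ≤ K ^ 2 * ∑ a ∈ spec (f x), hNorm (H x)
        (hAdjoint (H x) (f x) * specProj (spec (f x)) a (f x) -
          specProj (spec (f x)) a (f x) * hAdjoint (H x) (f x)) ^ 2 := by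
      rw [hu, Finset.mul_sum, Finset.mul_sum, spec_inFrame hP]
      refine Finset.sum_le_sum fun a ha => ?_
      rw [hHP, hNorm_commutator hP, ← specProj_inFrame hP]
      have h6 := hK d _ hsb a (by rwa [spec_inFrame hP])
      rw [spec_inFrame hP] at h6
      have h7 := pow_le_pow_left₀ (by positivity) h6 2
      rw [mul_pow, mul_pow] at h7
      linarith
    exact h5.trans (mul_le_mul_of_nonneg_left h3 (by positivity))
  set k := R ^ 2 - ‖x‖ ^ 2
  set u := excess f H x with hudef
  have h5 : u * (d ^ 2 * k ^ 2) ≤ u * (10 * K ^ 2) := by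
    have h6 := mul_le_mul_of_nonneg_left hlow (sq_nonneg k)
    have h7 := mul_le_mul_of_nonneg_left h4 (sq_nonneg K)
    linarith
  have key : d ^ 4 * (u * k ^ 4) ≤ n * B ^ 2 * (10 * K ^ 2) ^ 2 := by
    rcases hu0.eq_or_lt with h0 | h0
    · rw [← h0]
      simp only [zero_mul, mul_zero]
      positivity
    · have h6 := le_of_mul_le_mul_left h5 h0
      calc d ^ 4 * (u * k ^ 4) = u * (d ^ 2 * k ^ 2) ^ 2 := by ring
        _ ≤ (n * B ^ 2) * (10 * K ^ 2) ^ 2 := by gcongr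
  refine le_div_of_barrier hr hrR hz (mul_nonneg (by positivity)
    (excess_nonneg hH.isHermitianMetric
      (Metric.ball_subset_ball (hrR.le.trans hR₁.le) hz))) ?_
  refine le_trans ?_ key
  rw [mul_assoc]
  exact mul_le_mul_of_nonneg_left (hmax z (Metric.ball_subset_ball hrR.le hz)) (by positivity)

/-! ### The nilpotent part and the curvature -/

/-- In a unitary frame: if the spectral projections are Hermitian up to `O(d⁻²)`, the nilpotent part
`N` is controlled by `[Mᴴ, N]`, and `[M, Mᴴ]` by `N`. -/
theorem SpectralBounds.nilpotentPart_estimates {M : Matrix (Fin n) (Fin n) ℂ} {d₀ d A c D : ℝ}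
    (h : SpectralBounds d A c M) (hd₀ : 0 < d₀) (hd : d₀ ≤ d)
    (hD : ∀ a ∈ spec M, d ^ 2 * ‖specProj (spec M) a M - (specProj (spec M) a M)ᴴ‖ ≤ D) :
    ‖nilpotentPart M‖ ^ 2 ≤ n ^ 2 * (‖Mᴴ * nilpotentPart M - nilpotentPart M * Mᴴ‖ +
      2 * n * |A| * |D| / d₀ * ‖nilpotentPart M‖) ∧
    ‖M * Mᴴ - Mᴴ * M‖ ≤ 2 * ‖nilpotentPart M‖ ^ 2 + 2 * n * |A| * |D| / d₀ * ‖nilpotentPart M‖ +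
      2 * n * |A| * |D| * c := by
  have hd0 := h.pos
  set N := nilpotentPart M with hN
  set q : ℝ := 2 * n * |A| * |D| with hq
  have hq0 : 0 ≤ q := by positivity
  have hNp : aeval M (X - semisimplePoly (n + 1) (spec M)) = N := (nilpotentPart_eq_aeval M).symm
  have h1 := norm_commutator_sub_le h hD (X - semisimplePoly (n + 1) (spec M))
  rw [hNp, ← hN, ← hq] at h1
  have h2 := norm_commutator_sub_le h hD X
  rw [aeval_X, ← hN, ← hq] at h2
  have h3 : ‖(Mᴴ * N - N * Mᴴ) - (Nᴴ * N - N * Nᴴ)‖ ≤ q / d₀ * ‖N‖ := by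
    rw [div_mul_eq_mul_div, le_div_iff₀ hd₀]
    refine le_trans ?_ h1
    rw [mul_comm]
    exact mul_le_mul_of_nonneg_right hd (norm_nonneg _)
  have h4 : ‖(Mᴴ * M - M * Mᴴ) - (Nᴴ * M - M * Nᴴ)‖ ≤ q * c := by
    refine le_of_mul_le_mul_left (h2.trans ?_) hd0
    have := mul_le_mul_of_nonneg_left h.norm_le hq0
    linarith
  have h5 : ‖Nᴴ * M - M * Nᴴ‖ = ‖Mᴴ * N - N * Mᴴ‖ := by
    rw [← Matrix.frobenius_norm_conjTranspose]
    simp [Matrix.conjTranspose_sub, Matrix.conjTranspose_mul]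
  constructor
  · have h6 := norm_sq_le_of_eigenvalues (M := N) (B := 0)
      fun μ hμ => by simp [eigenvalues_nilpotentPart hμ]
    have h7 : ‖N * Nᴴ - Nᴴ * N‖ ≤ ‖Mᴴ * N - N * Mᴴ‖ + q / d₀ * ‖N‖ := by
      rw [norm_sub_rev]
      have := norm_sub_le (Mᴴ * N - N * Mᴴ) ((Mᴴ * N - N * Mᴴ) - (Nᴴ * N - N * Nᴴ))
      rw [sub_sub_cancel] at this
      linarith
    have h8 := mul_le_mul_of_nonneg_left h7 (sq_nonneg (n : ℝ))
    linarith
  · have h6 : ‖Mᴴ * N - N * Mᴴ‖ ≤ 2 * ‖N‖ ^ 2 + q / d₀ * ‖N‖ := by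
      have h7 := norm_add_le ((Mᴴ * N - N * Mᴴ) - (Nᴴ * N - N * Nᴴ)) (Nᴴ * N - N * Nᴴ)
      rw [sub_add_cancel] at h7
      have h8 := norm_sub_le (Nᴴ * N) (N * Nᴴ)
      have h9 := norm_mul_le Nᴴ N
      have h10 := norm_mul_le N Nᴴ
      rw [Matrix.frobenius_norm_conjTranspose] at h9 h10
      linarith
    have h7 := norm_add_le ((Mᴴ * M - M * Mᴴ) - (Nᴴ * M - M * Nᴴ)) (Nᴴ * M - M * Nᴴ)
    rw [sub_add_cancel, h5] at h7
    rw [norm_sub_rev]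
    linarith

theorem norm_specProj_sub_le_of_excess_le {f H : ℂ → Matrix (Fin n) (Fin n) ℂ} {z : ℂ} {d D : ℝ}
    {P : Matrix (Fin n) (Fin n) ℂ} (hP : IsUnit P.det) (hHP : H z = Pᴴ * P)
    (hD : d ^ 4 * excess f H z ≤ D) :
    ∀ a ∈ spec (inFrame P (f z)), d ^ 2 * ‖specProj (spec (inFrame P (f z))) a (inFrame P (f z)) -
      (specProj (spec (inFrame P (f z))) a (inFrame P (f z)))ᴴ‖ ≤ Real.sqrt (2 * D) := by
  intro a ha
  rw [excess_eq hP hHP] at hD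
  have h1 := Finset.single_le_sum (f := fun a =>
    ‖specProj (spec (inFrame P (f z))) a (inFrame P (f z)) -
      (specProj (spec (inFrame P (f z))) a (inFrame P (f z)))ᴴ‖ ^ 2 / 2)
    (fun _ _ => by positivity) ha
  have h2 := mul_le_mul_of_nonneg_left h1 (by positivity : 0 ≤ d ^ 4)
  refine Real.le_sqrt_of_sq_le ?_
  rw [mul_pow]
  nlinarith

/-- The nilpotent part of the Higgs field is bounded. -/
theorem exists_hNorm_nilpotentPart_le (n : ℕ) (A c D : ℝ) {d₀ r R : ℝ} (hd₀ : 0 < d₀) (hr : 0 < r)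
    (hrR : r < R) (hR₁ : R < 1) :
    ∃ C : ℝ, ∀ d, d₀ ≤ d → ∀ f H : ℂ → Matrix (Fin n) (Fin n) ℂ,
      MemS n d A f → IsHarmonicMetric f H → (∀ z ∈ disk R, hNorm (H z) (f z) ≤ c * d) →
      (∀ z ∈ disk R, d ^ 4 * excess f H z ≤ D) →
      ∀ z ∈ disk r, hNorm (H z) (nilpotentPart (f z)) ≤ C := by
  set ε : ℝ := 1 / (2 * (n ^ 2 + 1)) with hε
  have hε0 : 0 < ε := by positivity
  set κ : ℝ := 2 * n * |A| * |Real.sqrt (2 * D)| / d₀ with hκ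
  have hκ0 : 0 ≤ κ := by positivity
  refine ⟨Real.sqrt (((2 * (n ^ 2 + 1) * κ) ^ 2 + 4 / ε ^ 2) / (R ^ 2 - r ^ 2) ^ 4),
    fun d hd f H hf hH hc hD z hz => ?_⟩
  have hd0 := hd₀.trans_le hd
  refine Real.le_sqrt_of_sq_le (hH.hNorm_sq_le (s := fun w => nilpotentPart (f w)) hr hrR hR₁
    (by positivity) hε0 (fun z hz => hf.matHolomorphicAt_nilpotentPart hd0 hz) (fun z _ => ?_)
    (fun w hw hT => ?_) hz)
  · rw [nilpotentPart_eq_aeval]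
    have h1 := commute_aeval (f z) X (X - semisimplePoly (n + 1) (spec (f z)))
    rwa [aeval_X] at h1
  · have hw1 : w ∈ disk 1 := Metric.ball_subset_ball hR₁.le hw
    obtain ⟨P, hP, hHP⟩ := exists_frame (hH.isHermitianMetric.posDef w hw1)
    have hsb := hf.spectralBounds hd0 hw1 hP hHP (hc w hw)
    have h1 := (hsb.nilpotentPart_estimates hd₀ hd
      (norm_specProj_sub_le_of_excess_le hP hHP (hD w hw))).1
    rw [← hκ, nilpotentPart_inFrame hP] at h1
    rw [hHP] at hT ⊢
    rw [hNorm_commutator hP]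
    rw [hNorm_eq_norm_inFrame hP] at hT ⊢
    set N := inFrame P (nilpotentPart (f w)) with hN
    set e := ‖(inFrame P (f w))ᴴ * N - N * (inFrame P (f w))ᴴ‖ with he
    have h2 := (abs_le_of_sq_le_sq' hT (norm_nonneg N)).2
    have h3 := norm_nonneg N
    have h4 : 0 ≤ e := norm_nonneg _
    have h5 : 2 * (n ^ 2 + 1) * κ * ‖N‖ ≤ ‖N‖ ^ 2 := by
      rw [sq ‖N‖]; exact mul_le_mul_of_nonneg_right h2 h3
    have h6 : 0 ≤ κ * ‖N‖ := mul_nonneg hκ0 h3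
    rw [hε, one_div, inv_mul_le_iff₀ (by positivity)]
    nlinarith

/-- By Hitchin's equation the curvature is the commutator of the Higgs field with its adjoint. -/
theorem hNorm_chernCurvature_le {d₀ d A c D : ℝ} {f H : ℂ → Matrix (Fin n) (Fin n) ℂ} {z : ℂ}
    (hd₀ : 0 < d₀) (hd : d₀ ≤ d) (hf : MemS n d A f) (hH : IsHarmonicMetric f H)
    (hz : z ∈ disk 1) (hc : hNorm (H z) (f z) ≤ c * d) (hD : d ^ 4 * excess f H z ≤ D) :
    hNorm (H z) (chernCurvature H z) ≤ 2 * hNorm (H z) (nilpotentPart (f z)) ^ 2 +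
      2 * n * |A| * |Real.sqrt (2 * D)| / d₀ * hNorm (H z) (nilpotentPart (f z)) +
      2 * n * |A| * |Real.sqrt (2 * D)| * c := by
  obtain ⟨P, hP, hHP⟩ := exists_frame (hH.isHermitianMetric.posDef z hz)
  have hsb := hf.spectralBounds (hd₀.trans_le hd) hz hP hHP hc
  have h1 := (hsb.nilpotentPart_estimates hd₀ hd
    (norm_specProj_sub_le_of_excess_le hP hHP hD)).2
  rw [nilpotentPart_inFrame hP, ← hNorm_eq_norm_inFrame hP, ← hHP, norm_sub_rev,
    ← hNorm_commutator hP, ← hHP] at h1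
  rwa [eq_neg_of_add_eq_zero_left (hH.hitchin z hz), neg_sub]

end Higgs

end

theorem theoremB (n : ℕ) (r A d₀ : ℝ) (hr₀ : 0 < r) (hr₁ : r < 1) (hd₀ : 0 < d₀) :
    ∃ C : ℝ, 0 < C ∧
      ∀ (d : ℝ), d₀ ≤ d →
      ∀ (f H : ℂ → Matrix (Fin n) (Fin n) ℂ),
        Higgs.MemS n d A f → Higgs.IsHarmonicMetric f H →
        ∀ z ∈ Higgs.disk r,
          Higgs.hNorm (H z) (Higgs.nilpotentPart (f z)) ≤ C ∧
          Higgs.hNorm (H z) (Higgs.chernCurvature H z) ≤ C := by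
  -- each of the three estimates costs a shrinking of the disk
  obtain ⟨r₂, hr₂, hr₂'⟩ := exists_between hr₁
  obtain ⟨r₁, hr₁₂, hr₁'⟩ := exists_between hr₂'
  obtain ⟨R, hR, hR₁⟩ := exists_between hr₁'
  have hr₂0 := hr₀.trans hr₂
  have hr₁0 := hr₂0.trans hr₁₂
  obtain ⟨c, hc⟩ := Higgs.exists_hNorm_higgs_le n A hd₀ hr₁0 hR hR₁
  obtain ⟨D, hD⟩ := Higgs.exists_excess_le n A c hr₂0 hr₁₂ hr₁'
  obtain ⟨C, hC⟩ := Higgs.exists_hNorm_nilpotentPart_le n A c D hd₀ hr₀ hr₂ hr₂'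
  set κ : ℝ := 2 * n * |A| * |Real.sqrt (2 * D)| with hκ
  have hκ0 : 0 ≤ κ := by positivity
  set F : ℝ := 2 * C ^ 2 + κ / d₀ * |C| + κ * |c| with hF
  have hF0 : 0 ≤ F := by positivity
  refine ⟨|C| + F + 1, by positivity, fun d hd f H hf hH z hz => ?_⟩
  have hd0 := hd₀.trans_le hd
  have hz2 : z ∈ Higgs.disk r₂ := Metric.ball_subset_ball hr₂.le hz
  have hz1 : z ∈ Higgs.disk r₁ := Metric.ball_subset_ball hr₁₂.le hz2
  have hz0 : z ∈ Higgs.disk 1 := Metric.ball_subset_ball hr₁.le hz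
  have hc' := hc d hd f H hf hH
  have hD' := hD d hd0 f H hf hH hc'
  have hN := hC d hd f H hf hH
    (fun w hw => hc' w (Metric.ball_subset_ball hr₁₂.le hw)) hD' z hz
  refine ⟨by linarith [le_abs_self C], ?_⟩
  have h1 := Higgs.hNorm_chernCurvature_le hd₀ hd hf hH hz0 (hc' z hz1) (hD' z hz2)
  rw [← hκ] at h1
  have hN0 := Higgs.hNorm_nonneg (H z) (Higgs.nilpotentPart (f z))
  have h2 := pow_le_pow_left₀ hN0 hN 2
  have h3 := mul_le_mul_of_nonneg_left (hN.trans (le_abs_self C))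
    (by positivity : 0 ≤ κ / d₀)
  have h4 := mul_le_mul_of_nonneg_left (le_abs_self c) hκ0
  have h5 := abs_nonneg C
  linarith
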